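/- Let $\Gamma\subset\mathbb R^2$ be a Jordan curve (a homeomorphic image of the unit circle), let $\Omega$ be the bounded component of $\mathbb R^2\setminus\Gamma$, and define the signed distance function by $\operatorname{dist}^*(x,\Gamma)=\operatorname{dist}(x,\Gamma)$ for $x\in\Omega$ and $\operatorname{dist}^*(x,\Gamma)=-\operatorname{dist}(x,\Gamma)$ for $x\in\mathbb R^2\setminus\Omega$. For $\epsilon\in\mathbb R$ let $\gamma_\epsilon=\{x\in\mathbb R^2:\operatorname{dist}^*(x,\Gamma)=\epsilon\}$. For distinct $x,y\in\Gamma$ let $\Gamma(x,y)$ be the subarc of $\Gamma$ connecting $x$ and $y$ that has the smaller diameter (either of the two subarcs if the diameters agree), let $l_{x,y}$ be the infinite line through $x$ and $y$, and put $$\zeta_\Gamma(x,y)=\frac1{|x-y|}\sup_{z\in\Gamma(x,y)}\operatorname{dist}(z,l_{x,y}).$$ Suppose that for some $r_0>0$ the curve $\Gamma$ has the $(1/2,r_0)$-chordal property, that is, $\zeta_\Gamma(x,y)\le 1/2$ for all distinct $x,y\in\Gamma$ with $|x-y|\le r_0$. Then $\Gamma$ has the level Jordan curve property: there exists $\epsilon_0>0$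 such that $\gamma_\epsilon$ is a Jordan curve for every real $\epsilon$ with $0<|\epsilon|\le\epsilon_0$. Moreover, $\gamma_\epsilon$ is a Jordan curve for every real $\epsilon$ with $0<|\epsilon|<r_0/2$ for which some point $x\in\mathbb R^2$ satisfies $\operatorname{dist}^*(x,\Gamma)>\epsilon$ (a condition that always holds if $\epsilon<0$). -/

import Mathlib

namespace LevelJordan

/-- The Euclidean plane. -/
abbrev Plane : Type := EuclideanSpace ℝ (Fin 2)

/-- A Jordan curve: the image of the unit circle under a continuous injective map
(by compactness, a homeomorphic image of the circle). -/
def IsJordanCurve (Γ : Set Plane) : Prop :=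
  ∃ f : Circle → Plane, Continuous f ∧ Function.Injective f ∧ Set.range f = Γ

/-- An arc with endpoints `x` and `y`: the image of `[0, 1]` under a continuous injective map
that takes `0` to `x` and `1` to `y`. -/
def IsArc (σ : Set Plane) (x y : Plane) : Prop :=
  ∃ g : unitInterval → Plane,
    Continuous g ∧ Function.Injective g ∧ g 0 = x ∧ g 1 = y ∧ Set.range g = σ

/-- `σ` is a possible choice of `Γ(x, y)`: a subarc of `Γ` connecting `x` and `y` whose diameter
is smallest among the subarcs of `Γ` connecting `x` and `y`. For distinct points `x`, `y` of a
Jordan curve there are exactly two such subarcs; when their diameters agree, either one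
qualifies. -/
def IsSmallerSubarc (Γ : Set Plane) (x y : Plane) (σ : Set Plane) : Prop :=
  IsArc σ x y ∧ σ ⊆ Γ ∧
    ∀ τ : Set Plane, IsArc τ x y → τ ⊆ Γ → Metric.diam σ ≤ Metric.diam τ

/-- The quantity `ζ_Γ(x, y) = |x - y|⁻¹ * sup_{z ∈ σ} dist (z, l_{x,y})`, where `σ = Γ(x, y)` and
`l_{x,y}` is the infinite line through `x` and `y`. It is only used for `x ≠ y` and an arc `σ`,
which is compact and nonempty, so that the supremum is that of a nonempty bounded set. -/
noncomputable def chordalDeviation (σ : Set Plane) (x y : Plane) : ℝ :=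
  1 / dist x y * sSup ((fun z => Metric.infDist z (line[ℝ, x, y] : Set Plane)) '' σ)

/-- The `(ζ, r₀)`-chordal property: `ζ_Γ(x, y) ≤ ζ` for all distinct `x, y ∈ Γ` with
`|x - y| ≤ r₀`. When the two subarcs between `x` and `y` have the same diameter, it suffices
that one of them may be chosen as `Γ(x, y)`. -/
def HasChordalProperty (Γ : Set Plane) (ζ r₀ : ℝ) : Prop :=
  ∀ x ∈ Γ, ∀ y ∈ Γ, x ≠ y → dist x y ≤ r₀ →
    ∃ σ : Set Plane, IsSmallerSubarc Γ x y σ ∧ chordalDeviation σ x y ≤ ζ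

/-- The points off `Γ` whose connected component in the complement of `Γ` is bounded. For a Jordan
curve the complement has exactly one bounded component, and this set is that component. -/
def interiorDomain (Γ : Set Plane) : Set Plane :=
  {x | x ∈ Γᶜ ∧ Bornology.IsBounded (connectedComponentIn Γᶜ x)}

open scoped Classical in
/-- The signed distance to `Γ`, positive in the bounded component of the complement and
nonpositive elsewhere. -/
noncomputable def signedDistance (Γ : Set Plane) (x : Plane) : ℝ :=
  if x ∈ interiorDomain Γ then Metric.infDist x Γ else -Metric.infDist x Γ

/-- The `ε`-level set of the signed distance function. -/
def levelSet (Γ : Set Plane) (ε : ℝ) : Set Plane :=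
  {x | signedDistance Γ x = ε}

/-- The level Jordan curve property. -/
def HasLevelJordanCurveProperty (Γ : Set Plane) : Prop :=
  ∃ ε₀ : ℝ, 0 < ε₀ ∧ ∀ ε : ℝ, 0 < |ε| → |ε| ≤ ε₀ → IsJordanCurve (levelSet Γ ε)

end LevelJordan

/-!
The whole argument takes place in `ℂ`, and separation by a compact set is expressed through
continuous logarithms: if `(z - a) / (z - b)` has a continuous logarithm on a compact set `K`, then
`a` and `b` lie in the same component of the complement of `K`
(`connectedComponentIn_eq_of_hasLogOn`); conversely, points joined by a connected set off `K` have
such a logarithm (`hasLogOn_of_isPreconnected`). This also gives the part of the Jordan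
curve theorem that is needed: a Jordan curve separates the plane, and at most one complementary
component is bounded.

*Short chords do not separate.* Let `0 < e` and `2 * e < r₀`. If `p`, `q` are points of `Γ` at
distance less than `2 * e`, the chordal property confines the part of `Γ` between them to a strip of
width `|p - q|` about the line through `p` and `q`. A point at distance at least `e` from `Γ`
escapes to infinity perpendicularly to that line, so it does not link the loop formed by that
part and the chord. Hence a logarithm of `(z - a) / (z - b)` on `Γ` extends to the
`e`-neighbourhood of `Γ` when `a` and `b` have distance at least `e` from `Γ`
(`hasLogOn_infDist_lt`). As a first consequence, the points of a complementary component that are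
farther than `e` from `Γ` form a connected set.

*Local structure.* Let `x` be a point of the level set `X` at height `e` in a complementary
component `D`. Since `x` is not separated from `D`, the nearest points of `Γ` are seen from `x` at
angles with a continuous branch, and chords let this branch vary by at most `π`: either they all lie
in an open half plane about `x` (regular point), or they lie in a closed half plane and include the
two endpoints of its boundary diameter and the point in the direction perpendicular to it (critical
point); see `isRegularPoint_or_isCriticalPoint`. Near a regular point the distance function is
strictly monotone in a fixed direction, so `X` is a graph. Near a critical point `X` consists
of two graphs, tangent to each other at `x`, that bound a cusp; the logarithm lemma excludes that
this cusp is blocked arbitrarily close to `x`. In both cases `X` is locally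
connected by arcs at `x`, and `x` is a limit of points of `D` farther than `e` from `Γ`.

*Conclusion.* The complement of the compact set `X` is the union of two disjoint connected open
sets `U` (in `D`, farther than `e`) and `V` (the rest), so `(z - b) / (z - p)` has no continuous
logarithm on `X` for `b ∈ U` and `p ∈ V`. In a set that is locally connected by arcs and contains
no Jordan curve, logarithms always exist: the graph of the many-valued logarithm is a
covering of `X`, and an arc in it with endpoints over the same point would project to a curve that
contains a Jordan curve (`hasLogOn_of_no_isJordan`). So `X` contains a Jordan curve `C`. As all
points of `X` are limits both of `U` and of `V`, a point of `X` outside `C` would connect `U` with `V` in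
the complement of `C`, which is impossible because `C` separates the plane. Hence `X = C`.
-/

namespace LevelJordan

open Set Topology

/-! ### Continuous logarithms -/

/-- `h` has a continuous logarithm on the set `S`. -/
def HasLogOn (h : ℂ → ℂ) (S : Set ℂ) : Prop :=
  ∃ g : ℂ → ℂ, ContinuousOn g S ∧ ∀ z ∈ S, Complex.exp (g z) = h z

lemma HasLogOn.mono {h : ℂ → ℂ} {S T : Set ℂ} (H : HasLogOn h T) (hST : S ⊆ T) :
    HasLogOn h S := by
  obtain ⟨g, hg, he⟩ := H
  exact ⟨g, hg.mono hST, fun z hz => he z (hST hz)⟩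

/-- A continuous function with constant exponential on a preconnected set is constant there. -/
lemma eq_of_exp_eq {α : Type*} [TopologicalSpace α] {S : Set α} (hS : IsPreconnected S)
    {k : α → ℂ} (hk : ContinuousOn k S)
    (he : ∀ z ∈ S, ∀ w ∈ S, Complex.exp (k z) = Complex.exp (k w)) {z w : α}
    (hz : z ∈ S) (hw : w ∈ S) : k z = k w := by
  have hpi : (2 * Real.pi) ≠ 0 := by positivity
  have h1 : ∀ y ∈ S, ∃ n : ℤ, k y = k z + n * (2 * Real.pi * Complex.I) := fun y hy =>
    Complex.exp_eq_exp_iff_exists_int.1 (he y hy z hz)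
  have hmaps : MapsTo (fun y => (k y - k z).im / (2 * Real.pi)) S
      (Set.range ((↑) : ℤ → ℝ)) := by
    intro y hy
    obtain ⟨n, hn⟩ := h1 y hy
    refine ⟨n, ?_⟩
    have : (k y - k z).im = n * (2 * Real.pi) := by
      rw [hn]; simp
    simp only [this]; field_simp
  have hdisc : IsDiscrete (Set.range ((↑) : ℤ → ℝ)) :=
    ⟨Int.isClosedEmbedding_coe_real.isEmbedding.toHomeomorph.symm.isEmbedding.discreteTopology⟩
  have hcont : ContinuousOn (fun y => (k y - k z).im / (2 * Real.pi)) S := by fun_prop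
  have h2 := hS.constant_of_mapsTo hdisc hcont hmaps hw hz
  obtain ⟨n, hn⟩ := h1 w hw
  simp only [sub_self, Complex.zero_im, zero_div, div_eq_zero_iff, hpi, or_false] at h2
  have h3 : (n : ℝ) * (2 * Real.pi) = 0 := by rw [← h2, hn]; simp
  have h4 : (n : ℝ) = 0 := by simpa [hpi] using h3
  have h5 : n = 0 := by exact_mod_cast h4
  rw [hn, h5]; simp

/-- A continuous nonvanishing function on a real normed space has a continuous logarithm. -/
lemma exists_log {E : Type*} [NormedAddCommGroup E] [NormedSpace ℝ E] {F : E → ℂ}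
    (hF : Continuous F) (h0 : ∀ z, F z ≠ 0) :
    ∃ G : E → ℂ, Continuous G ∧ ∀ z, Complex.exp (G z) = F z := by
  have : LocallyPathConnectedSpace E := inferInstance
  obtain ⟨G, ⟨-, hG⟩, -⟩ := Complex.isCoveringMapOn_exp.existsUnique_continuousMap_lifts
    ⟨F, hF⟩ (a₀ := 0) (Complex.exp_log (h0 0)) (fun z => h0 z)
  exact ⟨G, G.continuous, fun z => congrFun hG z⟩

/-- A nonzero power of `z - a` has no continuous nonvanishing extension from the complement of a
disc to the plane. -/
lemma not_exists_extension {F : ℂ → ℂ} (hF : Continuous F) (h0 : ∀ z, F z ≠ 0) (a : ℂ) {n : ℤ}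
    (hn : n ≠ 0) {R : ℝ} (hR : 0 < R) (h : ∀ z, dist z a = R → F z = (z - a) ^ n) : False := by
  obtain ⟨G, hG, he⟩ := exists_log hF h0
  set c : ℝ → ℂ := fun t => a + R * Complex.exp (t * Complex.I) with hc
  have hcc : Continuous c := by fun_prop
  have hk : ∀ t, Complex.exp (G (c t) - n * (t * Complex.I)) = (R : ℂ) ^ n := by
    intro t
    have : dist (c t) a = R := by
      simp [hc, dist_eq_norm, Complex.norm_exp, abs_of_pos hR]
    rw [Complex.exp_sub, he, h _ this, Complex.exp_int_mul]
    simp only [hc, add_sub_cancel_left, mul_zpow]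
    field_simp
  have h1 := eq_of_exp_eq (S := (univ : Set ℝ)) isPreconnected_univ
    (k := fun t : ℝ => G (c t) - n * (t * Complex.I)) (by fun_prop)
    (fun z _ w _ => by rw [hk, hk]) (mem_univ 0) (mem_univ (2 * Real.pi))
  have h2 : c 0 = c (2 * Real.pi) := by
    simp [hc]
  simp only [h2] at h1
  have : (n : ℂ) * ((2 * Real.pi : ℝ) * Complex.I) = 0 := by
    have h3 := sub_right_injective h1
    simpa using h3.symm
  simp [hn, Real.pi_ne_zero] at this

/-- Points enclosed by a set are detected by logarithms: if `O` is a bounded open set containing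
`a`, then `(z - a) ^ n` times a function without zeros on the closure of `O` has no continuous
logarithm on the frontier of `O`. -/
lemma not_hasLogOn_frontier {O : Set ℂ} (hO : IsOpen O) (hb : Bornology.IsBounded O) {a : ℂ}
    (ha : a ∈ O) {k : ℂ → ℂ} (hk : ContinuousOn k (closure O)) (hk0 : ∀ z ∈ closure O, k z ≠ 0)
    {n : ℤ} (hn : n ≠ 0) {K : Set ℂ} (hK : frontier O ⊆ K)
    (H : HasLogOn (fun z => (z - a) ^ n * k z) K) : False := by
  classical
  obtain ⟨g, hg, he⟩ := H.mono hK
  obtain ⟨G, hG⟩ := ContinuousMap.exists_restrict_eq (isClosed_frontier (s := O))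
    ⟨(frontier O).domRestrict g, continuousOn_iff_continuous_domRestrict.1 hg⟩
  have hGg : ∀ z ∈ frontier O, G z = g z := fun z hz => by
    exact congrArg (fun f : C(frontier O, ℂ) => f ⟨z, hz⟩) hG
  set F : ℂ → ℂ := O.piecewise (fun z => Complex.exp (G z) / k z) (fun z => (z - a) ^ n) with hFdef
  have hne : ∀ z, z ∉ O → z - a ≠ 0 := fun z hz h => hz (by rwa [sub_eq_zero.1 h])
  have hF : Continuous F := by
    refine continuous_piecewise ?_ ?_ ?_
    · intro z hz
      rw [hGg z hz, he z hz]
      have := hk0 z (frontier_subset_closure hz)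
      field_simp
    · exact ContinuousOn.div (by fun_prop) hk hk0
    · have : closure Oᶜ = Oᶜ := hO.isClosed_compl.closure_eq
      rw [this]
      exact ContinuousOn.zpow₀ (by fun_prop) n (fun z hz => Or.inl (hne z hz))
  have hF0 : ∀ z, F z ≠ 0 := by
    intro z
    by_cases hz : z ∈ O
    · simp only [hFdef, piecewise_eq_of_mem _ _ _ hz]
      exact div_ne_zero (Complex.exp_ne_zero _) (hk0 z (subset_closure hz))
    · simp only [hFdef, piecewise_eq_of_notMem _ _ _ hz]
      exact zpow_ne_zero _ (hne z hz)
  obtain ⟨R, hR, hOR⟩ := hb.subset_ball_lt 0 a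
  refine not_exists_extension hF hF0 a hn hR fun z hz => ?_
  have : z ∉ O := fun h => by have := hOR h; simp [hz] at this
  simp only [hFdef, piecewise_eq_of_notMem _ _ _ this]

/-- Points in the same component of the complement of `K` cannot be told apart by logarithms
on `K`. -/
lemma hasLogOn_of_isPreconnected {K S : Set ℂ} (hK : IsClosed K) (hS : IsPreconnected S)
    (hSK : S ⊆ Kᶜ) {a b : ℂ} (ha : a ∈ S) (hb : b ∈ S) :
    HasLogOn (fun z => (z - a) / (z - b)) K := by
  have hne : ∀ {a z : ℂ}, a ∈ S → z ∈ K → z - a ≠ 0 := fun {a z} ha hz h =>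
    hSK ha (by rwa [← sub_eq_zero.1 h])
  refine hS.induction₂ (fun a b : ℂ => a ∈ S → b ∈ S → HasLogOn (fun z => (z - a) / (z - b)) K)
    ?_ ?_ ?_ ha hb ha hb
  · intro a ha
    obtain ⟨r, hr, hrK⟩ := Metric.isOpen_iff.1 hK.isOpen_compl a (hSK ha)
    filter_upwards [mem_nhdsWithin_of_mem_nhds (Metric.ball_mem_nhds a hr)] with b hb _ hbS
    have hslit : ∀ z ∈ K, (z - b) / (z - a) ∈ Complex.slitPlane := by
      intro z hz
      have h1 : (z - b) / (z - a) = 1 + (a - b) / (z - a) := by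
        have := hne ha hz
        field_simp; ring
      rw [h1]
      refine Complex.mem_slitPlane_of_norm_lt_one ?_
      have h2 : r ≤ ‖z - a‖ := by
        by_contra h
        exact hrK (by simpa [dist_eq_norm] using h) hz
      rw [norm_div, div_lt_one (by linarith)]
      have : ‖a - b‖ < r := by rw [← dist_eq_norm, dist_comm]; exact hb
      linarith
    refine ⟨fun z => - Complex.log ((z - b) / (z - a)), ?_, ?_⟩
    · refine (ContinuousOn.clog ?_ hslit).neg
      exact ContinuousOn.div (by fun_prop) (by fun_prop) (fun z hz => hne ha hz)
    · intro z hz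
      rw [Complex.exp_neg, Complex.exp_log (Complex.slitPlane_ne_zero (hslit z hz)), inv_div]
  · intro a b c _ hb' _ hab hbc ha hc
    have hb : b ∈ S := hb'
    obtain ⟨g, hg, he⟩ := hab ha hb
    obtain ⟨g', hg', he'⟩ := hbc hb hc
    refine ⟨fun z => g z + g' z, hg.add hg', fun z hz => ?_⟩
    rw [Complex.exp_add, he z hz, he' z hz]
    have := hne hb hz
    have := hne hc hz
    field_simp
  · intro a b _ _ h hb ha
    obtain ⟨g, hg, he⟩ := h ha hb
    exact ⟨fun z => - g z, hg.neg, fun z hz => by rw [Complex.exp_neg, he z hz, inv_div]⟩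

/-- The complement of a closed disc is connected. -/
lemma isPreconnected_compl_closedBall {R : ℝ} (hR : 0 ≤ R) :
    IsPreconnected (Metric.closedBall (0 : ℂ) R)ᶜ := by
  have h : (Metric.closedBall (0 : ℂ) R)ᶜ =
      (fun p : ℝ × ℝ => (p.1 : ℂ) * Complex.exp (p.2 * Complex.I)) '' (Ioi R ×ˢ univ) := by
    ext z
    simp only [mem_compl_iff, mem_closedBall_zero_iff, not_le, mem_image, mem_prod, mem_Ioi,
      mem_univ, and_true, Prod.exists]
    constructor
    · exact fun hz => ⟨‖z‖, z.arg, hz, Complex.norm_mul_exp_arg_mul_I z⟩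
    · rintro ⟨r, θ, hr, rfl⟩
      rw [norm_mul, Complex.norm_exp_ofReal_mul_I, Complex.norm_real, Real.norm_eq_abs,
        abs_of_pos (hR.trans_lt hr), mul_one]
      exact hr
  rw [h]
  exact (isPreconnected_Ioi.prod isPreconnected_univ).image _ (by fun_prop)

lemma connectedComponentIn_eq_of_not_isBounded {K : Set ℂ} (hK : Bornology.IsBounded K) {a b : ℂ}
    (ha : ¬ Bornology.IsBounded (connectedComponentIn Kᶜ a))
    (hb : ¬ Bornology.IsBounded (connectedComponentIn Kᶜ b)) :
    connectedComponentIn Kᶜ a = connectedComponentIn Kᶜ b := by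
  obtain ⟨R, hR0, hR⟩ := hK.subset_closedBall_lt 0 0
  have key : ∀ {a : ℂ}, ¬ Bornology.IsBounded (connectedComponentIn Kᶜ a) →
      (Metric.closedBall (0 : ℂ) R)ᶜ ⊆ connectedComponentIn Kᶜ a := by
    intro a ha
    obtain ⟨y, hy, hyR⟩ : ∃ y ∈ connectedComponentIn Kᶜ a, y ∉ Metric.closedBall (0 : ℂ) R := by
      by_contra! h
      exact ha (Metric.isBounded_closedBall.subset h)
    rw [connectedComponentIn_eq hy]
    exact (isPreconnected_compl_closedBall hR0.le).subset_connectedComponentIn hyR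
      (compl_subset_compl.2 hR)
  obtain ⟨y, hy, hyR⟩ : ∃ y ∈ connectedComponentIn Kᶜ a, y ∉ Metric.closedBall (0 : ℂ) R := by
    by_contra! h
    exact ha (Metric.isBounded_closedBall.subset h)
  rw [connectedComponentIn_eq (key ha hyR), connectedComponentIn_eq (key hb hyR)]

lemma frontier_connectedComponentIn_subset {K : Set ℂ} (hK : IsClosed K) (c : ℂ) :
    frontier (connectedComponentIn Kᶜ c) ⊆ K := by
  intro z hz
  by_contra hzK
  have ho : IsOpen (connectedComponentIn Kᶜ z) := hK.isOpen_compl.connectedComponentIn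
  obtain ⟨y, hyz, hyc⟩ := mem_closure_iff.1 (frontier_subset_closure hz) _ ho
    (mem_connectedComponentIn hzK)
  have h1 := connectedComponentIn_eq hyz
  have h2 := connectedComponentIn_eq hyc
  have h3 : z ∈ connectedComponentIn Kᶜ c := by
    rw [h2, ← h1]; exact mem_connectedComponentIn hzK
  have h4 : IsOpen (connectedComponentIn Kᶜ c) := hK.isOpen_compl.connectedComponentIn
  rw [h4.frontier_eq] at hz
  exact hz.2 h3

/-- If `(z - a) / (z - b)` has a continuous logarithm on the compact set `K`, then `K` does not
separate `a` from `b`. -/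
lemma connectedComponentIn_eq_of_hasLogOn {K : Set ℂ} (hK : IsCompact K) {a b : ℂ}
    (ha : a ∉ K) (hb : b ∉ K) (H : HasLogOn (fun z => (z - a) / (z - b)) K) :
    connectedComponentIn Kᶜ a = connectedComponentIn Kᶜ b := by
  have hfr := frontier_connectedComponentIn_subset hK.isClosed
  have main : ∀ {a b : ℂ}, a ∉ K → b ∉ K → HasLogOn (fun z => (z - a) / (z - b)) K →
      Bornology.IsBounded (connectedComponentIn Kᶜ a) →
      connectedComponentIn Kᶜ a = connectedComponentIn Kᶜ b := by
    intro a b ha hb H hbd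
    by_contra hne
    have hbO : b ∉ closure (connectedComponentIn Kᶜ a) := by
      rw [closure_eq_self_union_frontier]
      rintro (h | h)
      · exact hne (connectedComponentIn_eq h)
      · exact hb (hfr a h)
    refine not_hasLogOn_frontier (hK.isClosed.isOpen_compl.connectedComponentIn) hbd
      (mem_connectedComponentIn ha) (k := fun z => (z - b)⁻¹) (n := 1) ?_ ?_ one_ne_zero (hfr a) ?_
    · refine ContinuousOn.inv₀ (by fun_prop) fun z hz h => hbO ?_
      rwa [← sub_eq_zero.1 h]
    · intro z hz
      refine inv_ne_zero fun h => hbO ?_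
      rwa [← sub_eq_zero.1 h]
    · simpa [div_eq_mul_inv] using H
  by_cases h1 : Bornology.IsBounded (connectedComponentIn Kᶜ a)
  · exact main ha hb H h1
  by_cases h2 : Bornology.IsBounded (connectedComponentIn Kᶜ b)
  · refine (main hb ha ?_ h2).symm
    obtain ⟨g, hg, he⟩ := H
    exact ⟨fun z => - g z, hg.neg, fun z hz => by rw [Complex.exp_neg, he z hz, inv_div]⟩
  · exact connectedComponentIn_eq_of_not_isBounded hK.isBounded h1 h2

/-! ### Separation of the plane by Jordan curves -/

/-- A Jordan curve in the complex plane. -/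
def IsJordan (C : Set ℂ) : Prop :=
  ∃ f : Circle → ℂ, Continuous f ∧ Function.Injective f ∧ range f = C

/-- Off a path from `p` to `q`, the function `(z - q) / (z - p)` has a continuous logarithm:
it is homotopic to the constant `1` when `q` moves to `p` along the path. -/
lemma hasLogOn_compl_range {f : unitInterval → ℂ} (hf : Continuous f) :
    HasLogOn (fun z => (z - f 1) / (z - f 0)) (range f)ᶜ := by
  classical
  have hne : ∀ (t : unitInterval) (z : ((range f)ᶜ : Set ℂ)), (z : ℂ) - f t ≠ 0 := fun t z h =>
    z.2 ⟨t, (sub_eq_zero.1 h).symm⟩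
  let H : C(unitInterval × ((range f)ᶜ : Set ℂ), {z : ℂ // z ≠ 0}) :=
    ⟨fun x => ⟨((x.2 : ℂ) - f x.1) / (x.2 - f 0), div_ne_zero (hne _ _) (hne _ _)⟩, by
      refine Continuous.subtype_mk (Continuous.div ?_ ?_ fun x => hne _ _) _
      · exact (continuous_subtype_val.comp continuous_snd).sub (hf.comp continuous_fst)
      · exact (continuous_subtype_val.comp continuous_snd).sub continuous_const⟩
  have h0 : ∀ a, H (0, a) = (⟨_, Complex.exp_ne_zero ((0 : C(((range f)ᶜ : Set ℂ), ℂ)) a)⟩ :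
      {z : ℂ // z ≠ 0}) := by
    intro a
    simp [H, div_self (hne 0 a)]
  let L := Complex.isCoveringMap_exp.liftHomotopy H 0 h0
  have hL : ∀ x, Complex.exp (L x) = H x := fun x =>
    congrArg Subtype.val (congrFun (Complex.isCoveringMap_exp.liftHomotopy_lifts H 0 h0) x)
  refine ⟨fun z => if hz : z ∈ (range f)ᶜ then L (1, ⟨z, hz⟩) else 0, ?_, ?_⟩
  · rw [continuousOn_iff_continuous_domRestrict]
    have : Continuous fun z : ((range f)ᶜ : Set ℂ) => L (1, z) := by fun_prop
    refine this.congr fun z => ?_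
    simp only [domRestrict_apply]
    rw [dif_pos z.2]
  · intro z hz
    simp only [dif_pos hz]
    rw [hL]
    rfl

/-- A Jordan curve separates the plane. -/
lemma IsJordan.not_isPreconnected_compl {C : Set ℂ} (hC : IsJordan C) : ¬ IsPreconnected Cᶜ := by
  classical
  rintro hconn
  obtain ⟨f, hf, hinj, rfl⟩ := hC
  -- The curve is the union of the images `A` and `B` of the two half circles, joining `p` to `q`.
  set α : unitInterval → ℂ := fun t => f (Circle.exp (Real.pi * t)) with hα
  set β : unitInterval → ℂ := fun t => f (Circle.exp (-(Real.pi * t))) with hβ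
  have hαc : Continuous α := by fun_prop
  have hβc : Continuous β := by fun_prop
  set p := f 1 with hp
  set q := f (Circle.exp Real.pi) with hq
  have hpi : Circle.exp Real.pi = -1 := by ext; simp
  have hpq : p ≠ q := by
    intro h
    have := congrArg (Subtype.val) (hinj h)
    rw [hpi] at this
    norm_num at this
  have hneg : Circle.exp (-Real.pi) = Circle.exp Real.pi := by ext; simp
  have hα0 : α 0 = p := by simp [hα, hp]
  have hβ0 : β 0 = p := by simp [hβ, hp]
  have hα1 : α 1 = q := by simp [hα, hq]
  have hβ1 : β 1 = q := by simp only [hβ, hq, Icc.coe_one, mul_one, hneg]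
  have hunion : range f = range α ∪ range β := by
    apply subset_antisymm
    · rintro _ ⟨w, rfl⟩
      have hw := Circle.exp_arg w
      have h1 := Complex.neg_pi_lt_arg (w : ℂ)
      have h2 := Complex.arg_le_pi (w : ℂ)
      rcases le_total 0 (Complex.arg w) with h | h
      · left
        refine ⟨⟨Complex.arg w / Real.pi, by positivity, by
          rw [div_le_one Real.pi_pos]; exact h2⟩, ?_⟩
        simp only [hα]
        rw [mul_div_cancel₀ _ Real.pi_ne_zero, hw]
      · right
        refine ⟨⟨-Complex.arg w / Real.pi, div_nonneg (by linarith) Real.pi_pos.le, by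
          rw [div_le_one Real.pi_pos]; linarith⟩, ?_⟩
        simp only [hβ]
        rw [mul_div_cancel₀ _ Real.pi_ne_zero, neg_neg, hw]
    · rintro _ (⟨t, rfl⟩ | ⟨t, rfl⟩) <;> exact ⟨_, rfl⟩
  have hinter : range α ∩ range β ⊆ {p, q} := by
    rintro _ ⟨⟨t, rfl⟩, ⟨s, hs⟩⟩
    have h1 := Circle.exp_eq_exp.1 (hinj hs)
    obtain ⟨m, hm⟩ := h1
    have hts : (-(s : ℝ)) = t + m * 2 := by
      have := Real.pi_pos
      have h2 : Real.pi * (-(s : ℝ) - t - m * 2) = 0 := by linarith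
      rcases mul_eq_zero.1 h2 with h | h
      · linarith
      · linarith
    have ht0 := t.2.1
    have ht1 := t.2.2
    have hs0 := s.2.1
    have hs1 := s.2.2
    have hm0 : m ≤ 0 := by
      have : (m : ℝ) ≤ 0 := by linarith
      exact_mod_cast this
    have hm1 : -1 ≤ m := by
      have : (-1 : ℝ) ≤ m := by linarith
      exact_mod_cast this
    have : m = 0 ∨ m = -1 := by omega
    rcases this with rfl | rfl
    · left
      have : t = 0 := Subtype.ext (by push_cast at hts; rw [Icc.coe_zero]; linarith)
      rw [this, hα0]
    · right
      have : t = 1 := Subtype.ext (by push_cast at hts; rw [Icc.coe_one]; linarith)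
      rw [this, hα1]; rfl
  obtain ⟨LA, hLA, heA⟩ := hasLogOn_compl_range hαc
  obtain ⟨LB, hLB, heB⟩ := hasLogOn_compl_range hβc
  rw [hα0, hα1] at heA
  rw [hβ0, hβ1] at heB
  have hAc : IsOpen (range α)ᶜ := (isCompact_range hαc).isClosed.isOpen_compl
  have hBc : IsOpen (range β)ᶜ := (isCompact_range hβc).isClosed.isOpen_compl
  have hCA : (range f)ᶜ ⊆ (range α)ᶜ := compl_subset_compl.2 (hunion ▸ subset_union_left)
  have hCB : (range f)ᶜ ⊆ (range β)ᶜ := compl_subset_compl.2 (hunion ▸ subset_union_right)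
  -- The two logarithms differ by a constant `c` on the connected complement of the curve.
  obtain ⟨c, hc1, hc⟩ : ∃ c : ℂ, Complex.exp c = 1 ∧ ∀ z ∈ (range f)ᶜ, LA z - LB z = c := by
    by_cases hne : ((range f)ᶜ : Set ℂ).Nonempty
    · obtain ⟨z0, hz0⟩ := hne
      have hexp : ∀ z ∈ (range f)ᶜ, Complex.exp (LA z - LB z) = 1 := by
        intro z hz
        rw [Complex.exp_sub, heA z (hCA hz), heB z (hCB hz), div_self]
        rw [← heA z (hCA hz)]
        exact Complex.exp_ne_zero _
      refine ⟨LA z0 - LB z0, hexp z0 hz0, fun z hz => ?_⟩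
      exact eq_of_exp_eq hconn (k := fun z => LA z - LB z) ((hLA.mono hCA).sub (hLB.mono hCB))
        (fun z hz w hw => by rw [hexp z hz, hexp w hw]) hz hz0
    · exact ⟨0, Complex.exp_zero, fun z hz => (hne ⟨z, hz⟩).elim⟩
  have hLB' : ∀ z ∈ (range β)ᶜ, (if z ∈ range α then LB z + c else LA z) = LB z + c := by
    intro z hz
    split_ifs with h
    · rfl
    · rw [← hc z (by rw [hunion]; exact fun h' => h'.elim h hz)]; ring
  have hlog : HasLogOn (fun z => (z - q) / (z - p)) {p, q}ᶜ := by
    refine ⟨fun z => if z ∈ range α then LB z + c else LA z, ?_, ?_⟩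
    · intro z hz
      have : z ∈ (range α)ᶜ ∨ z ∈ (range β)ᶜ := by
        by_contra! h
        simp only [mem_compl_iff, not_not] at h
        exact hz (hinter h)
      apply ContinuousAt.continuousWithinAt
      rcases this with h | h
      · refine (hLA.continuousAt (hAc.mem_nhds h)).congr ?_
        filter_upwards [hAc.mem_nhds h] with w hw
        rw [if_neg hw]
      · have h1 : ContinuousAt (fun w => LB w + c) z :=
          (hLB.continuousAt (hBc.mem_nhds h)).add continuousAt_const
        refine h1.congr ?_
        filter_upwards [hBc.mem_nhds h] with w hw
        exact (hLB' w hw).symm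
    · intro z hz
      by_cases h : z ∈ range α
      · have h' : z ∉ range β := fun h' => hz (hinter ⟨h, h'⟩)
        simp only [if_pos h]
        rw [Complex.exp_add, hc1, mul_one, heB z h']
      · simp only [if_neg h]
        exact heA z h
  have hd : 0 < dist q p := dist_pos.2 hpq.symm
  have hcl : ∀ z ∈ closure (Metric.ball q (dist q p / 2)), z - p ≠ 0 := by
    intro z hz h
    have h1 := Metric.closure_ball_subset_closedBall hz
    rw [sub_eq_zero.1 h, Metric.mem_closedBall, dist_comm] at h1
    linarith
  refine not_hasLogOn_frontier (Metric.isOpen_ball (x := q) (ε := dist q p / 2))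
    Metric.isBounded_ball (Metric.mem_ball_self (by linarith)) (k := fun z => (z - p)⁻¹) (n := 1)
    (ContinuousOn.inv₀ (by fun_prop) hcl) (fun z hz => inv_ne_zero (hcl z hz)) one_ne_zero
    subset_rfl ?_
  refine HasLogOn.mono (T := {p, q}ᶜ) (by simpa [div_eq_mul_inv] using hlog) ?_
  intro z hz
  simp only [mem_compl_iff, mem_insert_iff, mem_singleton_iff, not_or]
  refine ⟨fun h => hcl z (frontier_subset_closure hz) (by rw [h, sub_self]), ?_⟩
  rintro rfl
  rw [Metric.isOpen_ball.frontier_eq] at hz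
  exact hz.2 (Metric.mem_ball_self (by linarith))

/-- A point off a Jordan curve has a winding number, the increment (over `2 π i`) of the
logarithm of `f - a` along the curve. -/
lemma exists_winding {f : Circle → ℂ} (hf : Continuous f) {a : ℂ} (ha : a ∉ range f) :
    ∃ (G : ℝ → ℂ) (n : ℤ), Continuous G ∧ (∀ t, Complex.exp (G t) = f (Circle.exp t) - a) ∧
      G (2 * Real.pi) = G 0 + n * (2 * Real.pi * Complex.I) := by
  obtain ⟨G, hG, he⟩ := exists_log (F := fun t : ℝ => f (Circle.exp t) - a) (by fun_prop)
    (fun t h => ha ⟨_, sub_eq_zero.1 h⟩)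
  obtain ⟨n, hn⟩ := Complex.exp_eq_exp_iff_exists_int.1
    (show Complex.exp (G (2 * Real.pi)) = Complex.exp (G 0) by rw [he, he]; simp)
  exact ⟨G, n, hG, he, hn⟩

/-- A continuous function on `[0, 2π]` with equal end values descends to a function on a Jordan
curve. -/
lemma exists_descend {f : Circle → ℂ} (hf : Continuous f) (hinj : Function.Injective f)
    {G : ℝ → ℂ} (hG : Continuous G) (h : G 0 = G (2 * Real.pi)) :
    ∃ g : ℂ → ℂ, ContinuousOn g (range f) ∧
      ∀ z ∈ range f, ∃ t, z = f (Circle.exp t) ∧ g z = G t := by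
  have : Fact (0 < 2 * Real.pi) := ⟨by positivity⟩
  let G' : AddCircle (2 * Real.pi) → ℂ := AddCircle.liftIco (2 * Real.pi) 0 G
  have hG' : Continuous G' := AddCircle.liftIco_zero_continuous h hG.continuousOn
  let e := AddCircle.homeomorphCircle'
  have hemb := (hf.isClosedEmbedding hinj).isEmbedding
  have hleft : Function.LeftInverse (Function.invFun f) f := Function.leftInverse_invFun hinj
  refine ⟨fun z => G' (e.symm (Function.invFun f z)), ?_, ?_⟩
  · refine (hG'.comp e.symm.continuous).comp_continuousOn ?_
    rw [continuousOn_iff_continuous_domRestrict]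
    have : (range f).domRestrict (Function.invFun f) = hemb.toHomeomorph.symm := by
      ext ⟨_, w, rfl⟩
      have : (⟨f w, w, rfl⟩ : range f) = hemb.toHomeomorph w := rfl
      rw [this, Homeomorph.symm_apply_apply]
      simp [hleft w]
    rw [this]
    exact hemb.toHomeomorph.symm.continuous
  · rintro _ ⟨w, rfl⟩
    obtain ⟨t, ht, hte⟩ : e.symm w ∈
        ((↑) : ℝ → AddCircle (2 * Real.pi)) '' Ico 0 (0 + 2 * Real.pi) := by
      rw [AddCircle.coe_image_Ico_eq]; exact mem_univ _
    rw [zero_add] at ht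
    refine ⟨t, ?_, ?_⟩
    · have : w = e t := by rw [hte, Homeomorph.apply_symm_apply]
      rw [this]
      congr 1
    · simp only [hleft w, ← hte, G']
      exact AddCircle.liftIco_zero_coe_apply ht

/-- The complement of a Jordan curve has at most one bounded component. -/
lemma IsJordan.connectedComponentIn_eq {C : Set ℂ} (hC : IsJordan C) {a b : ℂ} (ha : a ∈ Cᶜ)
    (hb : b ∈ Cᶜ) (hab : Bornology.IsBounded (connectedComponentIn Cᶜ a))
    (hbb : Bornology.IsBounded (connectedComponentIn Cᶜ b)) :
    connectedComponentIn Cᶜ a = connectedComponentIn Cᶜ b := by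
  obtain ⟨f, hf, hinj, rfl⟩ := hC
  by_contra hne
  have hcl : IsClosed (range f) := (isCompact_range hf).isClosed
  have hfr := frontier_connectedComponentIn_subset hcl
  obtain ⟨G, n, hG, hGe, hGn⟩ := exists_winding hf ha
  obtain ⟨G', m, hG', hGe', hGm⟩ := exists_winding hf hb
  have hopen : ∀ c, IsOpen (connectedComponentIn (range f)ᶜ c) := fun c =>
    hcl.isOpen_compl.connectedComponentIn
  -- The winding number `m` about `b` is not zero.
  have hm : m ≠ 0 := by
    rintro rfl
    obtain ⟨g, hg, hgt⟩ := exists_descend hf hinj hG' (by simpa using hGm.symm)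
    refine not_hasLogOn_frontier (hopen b) hbb (mem_connectedComponentIn hb) (k := fun _ => 1)
      (n := 1) continuousOn_const (fun _ _ => one_ne_zero) one_ne_zero (hfr b) ⟨g, hg, ?_⟩
    intro z hz
    obtain ⟨t, rfl, hgz⟩ := hgt z hz
    rw [hgz, hGe']; simp
  obtain ⟨g, hg, hgt⟩ := exists_descend hf hinj (G := fun t => m * G t - n * G' t) (by fun_prop)
    (by simp only [hGn, hGm]; ring)
  have hbO : ∀ z ∈ closure (connectedComponentIn (range f)ᶜ a), z - b ≠ 0 := by
    intro z hz h
    rw [sub_eq_zero.1 h, closure_eq_self_union_frontier] at hz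
    rcases hz with hz | hz
    · exact hne (_root_.connectedComponentIn_eq hz)
    · exact hb (hfr a hz)
  refine not_hasLogOn_frontier (hopen a) hab (mem_connectedComponentIn ha)
    (k := fun z => (z - b) ^ (-n)) (n := m)
    (ContinuousOn.zpow₀ (by fun_prop) _ fun z hz => Or.inl (hbO z hz))
    (fun z hz => zpow_ne_zero _ (hbO z hz)) hm (hfr a) ⟨g, hg, ?_⟩
  intro z hz
  obtain ⟨t, rfl, hgz⟩ := hgt z hz
  rw [hgz, Complex.exp_sub, Complex.exp_int_mul, Complex.exp_int_mul, hGe, hGe', div_eq_mul_inv]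
  simp only [zpow_neg]

/-! ### Arcs and Jordan curves in locally arcwise connected sets -/

/-- `x` and `y` are equal points of `S` or the end points of an arc in `S`. The arc is
parametrized by an arbitrary compact interval `[a, b]`; the case `a = b` is that of equal points. -/
def ArcJoined {M : Type*} [TopologicalSpace M] (S : Set M) (x y : M) : Prop :=
  ∃ (a b : ℝ) (γ : ℝ → M), a ≤ b ∧ ContinuousOn γ (Icc a b) ∧ InjOn γ (Icc a b) ∧
    MapsTo γ (Icc a b) S ∧ γ a = x ∧ γ b = y

namespace ArcJoined

variable {M : Type*} [TopologicalSpace M] {S T : Set M} {x y z : M}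

lemma refl (hx : x ∈ S) : ArcJoined S x x :=
  ⟨0, 0, fun _ => x, le_rfl, continuousOn_const, by simp, fun _ _ => hx, rfl, rfl⟩

lemma mono (h : ArcJoined S x y) (hST : S ⊆ T) : ArcJoined T x y := by
  obtain ⟨a, b, γ, hab, hc, hi, hm, hx, hy⟩ := h
  exact ⟨a, b, γ, hab, hc, hi, fun t ht => hST (hm ht), hx, hy⟩

lemma symm (h : ArcJoined S x y) : ArcJoined S y x := by
  obtain ⟨a, b, γ, hab, hc, hi, hm, hx, hy⟩ := h
  have hmaps : MapsTo (fun t : ℝ => -t) (Icc (-b) (-a)) (Icc a b) := fun t ht =>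
    ⟨by linarith [ht.2], by linarith [ht.1]⟩
  exact ⟨-b, -a, fun t => γ (-t), by linarith, hc.comp (by fun_prop) hmaps,
    hi.comp neg_injective.injOn hmaps, hm.comp hmaps, by simpa, by simpa⟩

/-- The image of an arc under an injective continuous map. -/
lemma map {N : Type*} [TopologicalSpace N] {U : Set N} (h : ArcJoined S x y) {φ : M → N}
    (hφ : ContinuousOn φ S) (hi : InjOn φ S) (hm : MapsTo φ S U) :
    ArcJoined U (φ x) (φ y) := by
  obtain ⟨a, b, γ, hab, hc, hj, hmS, rfl, rfl⟩ := h
  exact ⟨a, b, φ ∘ γ, hab, hφ.comp hc hmS, hi.comp hj hmS, hm.comp hmS, rfl, rfl⟩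

/-- Two arcs with a common end point contain an arc joining their other end points: follow the
first one up to the first point on the second one. -/
lemma trans [T2Space M] (h : ArcJoined S x y) (h' : ArcJoined S y z) : ArcJoined S x z := by
  obtain ⟨a, b, α, hab, hαc, hαi, hαS, hx, hy⟩ := h
  obtain ⟨c, d, β, hcd, hβc, hβi, hβS, hy', hz⟩ := h'
  have hcl : IsClosed (β '' Icc c d) := (isCompact_Icc.image_of_continuousOn hβc).isClosed
  have hcpt : IsCompact (Icc a b ∩ α ⁻¹' (β '' Icc c d)) :=
    isCompact_Icc.of_isClosed_subset (hαc.preimage_isClosed_of_isClosed isClosed_Icc hcl)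
      inter_subset_left
  obtain ⟨t₀, ⟨ht₀, s₀, hs₀, hst⟩, hmin⟩ := hcpt.exists_isLeast
    ⟨b, right_mem_Icc.2 hab, c, left_mem_Icc.2 hcd, by rw [hy', hy]⟩
  set γ : ℝ → M := fun t => if t ≤ t₀ then α t else β (t - t₀ + s₀) with hγ
  have hγ1 : ∀ t, t ≤ t₀ → γ t = α t := fun t ht => by simp [hγ, ht]
  have hγ2 : ∀ t, t₀ ≤ t → γ t = β (t - t₀ + s₀) := by
    intro t ht
    rcases ht.eq_or_lt with rfl | h
    · simp [hγ, hst]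
    · simp [hγ, h.not_ge]
  have hu : Icc a (t₀ + (d - s₀)) = Icc a t₀ ∪ Icc t₀ (t₀ + (d - s₀)) :=
    (Icc_union_Icc_eq_Icc ht₀.1 (by linarith [hs₀.2])).symm
  have hm1 : ∀ t ∈ Icc a t₀, t ∈ Icc a b := fun t ht => ⟨ht.1, ht.2.trans ht₀.2⟩
  have hm2 : ∀ t ∈ Icc t₀ (t₀ + (d - s₀)), t - t₀ + s₀ ∈ Icc c d := fun t ht =>
    ⟨by linarith [hs₀.1, ht.1], by linarith [ht.2]⟩
  have hkey : ∀ t ∈ Icc a t₀, ∀ t' ∈ Icc t₀ (t₀ + (d - s₀)), γ t = γ t' → t = t' := by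
    intro t ht t' ht' h
    rw [hγ1 t ht.2, hγ2 t' ht'.1] at h
    have h1 : t₀ ≤ t := hmin ⟨hm1 t ht, _, hm2 t' ht', h.symm⟩
    have h2 : t = t₀ := le_antisymm ht.2 h1
    rw [h2, ← hst] at h
    have := hβi hs₀ (hm2 t' ht') h
    linarith
  refine ⟨a, t₀ + (d - s₀), γ, by linarith [ht₀.1, hs₀.2], ?_, ?_, ?_, ?_, ?_⟩
  · rw [hu]
    refine ContinuousOn.union_of_isClosed ?_ ?_ isClosed_Icc isClosed_Icc
    · exact (hαc.mono hm1).congr fun t ht => hγ1 t ht.2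
    · refine ContinuousOn.congr ?_ fun t ht => hγ2 t ht.1
      exact hβc.comp (by fun_prop) hm2
  · rw [hu]
    rintro t (ht | ht) t' (ht' | ht') h
    · rw [hγ1 t ht.2, hγ1 t' ht'.2] at h
      exact hαi (hm1 t ht) (hm1 t' ht') h
    · exact hkey t ht t' ht' h
    · exact (hkey t' ht' t ht h.symm).symm
    · rw [hγ2 t ht.1, hγ2 t' ht'.1] at h
      have := hβi (hm2 t ht) (hm2 t' ht') h
      linarith
  · rw [hu]
    rintro t (ht | ht)
    · rw [hγ1 t ht.2]; exact hαS (hm1 t ht)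
    · rw [hγ2 t ht.1]; exact hβS (hm2 t ht)
  · rw [hγ1 a ht₀.1, hx]
  · rw [hγ2 _ (by linarith [hs₀.2])]
    simp [hz]

end ArcJoined

/-- A closed path which is injective except for its end points traces a Jordan curve. -/
lemma isJordan_image_Icc {a b : ℝ} (hab : a < b) {γ : ℝ → ℂ} (hc : ContinuousOn γ (Icc a b))
    (he : γ a = γ b) (hi : InjOn γ (Ico a b)) : IsJordan (γ '' Icc a b) := by
  have hp : (0 : ℝ) < 2 * Real.pi := by positivity
  have : Fact (0 < 2 * Real.pi) := ⟨hp⟩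
  set δ : ℝ → ℂ := fun t => γ (a + (b - a) / (2 * Real.pi) * t) with hδ
  have hba : 0 < b - a := sub_pos.2 hab
  have hmIcc : MapsTo (fun t : ℝ => a + (b - a) / (2 * Real.pi) * t) (Icc 0 (2 * Real.pi))
      (Icc a b) := by
    intro t ht
    have h1 : (b - a) / (2 * Real.pi) * t ≤ (b - a) / (2 * Real.pi) * (2 * Real.pi) := by
      gcongr; exact ht.2
    rw [div_mul_cancel₀ _ hp.ne'] at h1
    have h2 : 0 ≤ (b - a) / (2 * Real.pi) * t := mul_nonneg (by positivity) ht.1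
    exact ⟨by linarith, by linarith⟩
  have hmIco : MapsTo (fun t : ℝ => a + (b - a) / (2 * Real.pi) * t) (Ico 0 (2 * Real.pi))
      (Ico a b) := by
    intro t ht
    have h1 : (b - a) / (2 * Real.pi) * t < (b - a) / (2 * Real.pi) * (2 * Real.pi) := by
      gcongr; exact ht.2
    rw [div_mul_cancel₀ _ hp.ne'] at h1
    have h2 : 0 ≤ (b - a) / (2 * Real.pi) * t := mul_nonneg (by positivity) ht.1
    exact ⟨by linarith, by linarith⟩
  have hδc : ContinuousOn δ (Icc 0 (2 * Real.pi)) := hc.comp (by fun_prop) hmIcc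
  have hδe : δ 0 = δ (2 * Real.pi) := by
    simp only [hδ, mul_zero, add_zero]
    rw [div_mul_cancel₀ _ hp.ne', add_sub_cancel, he]
  have hδi : InjOn δ (Ico 0 (2 * Real.pi)) := by
    refine hi.comp (Function.Injective.injOn ?_) hmIco
    intro t t' h
    have h3 : (b - a) / (2 * Real.pi) ≠ 0 := by positivity
    exact mul_left_cancel₀ h3 (add_left_cancel h)
  let F : AddCircle (2 * Real.pi) → ℂ := AddCircle.liftIco (2 * Real.pi) 0 δ
  have hF : Continuous F := AddCircle.liftIco_zero_continuous hδe hδc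
  have hrep : ∀ u : AddCircle (2 * Real.pi), ∃ t ∈ Ico 0 (2 * Real.pi), (t : AddCircle _) = u := by
    intro u
    have : u ∈ ((↑) : ℝ → AddCircle (2 * Real.pi)) '' Ico 0 (0 + 2 * Real.pi) := by
      rw [AddCircle.coe_image_Ico_eq]; exact mem_univ _
    rwa [zero_add] at this
  have hFc : ∀ t ∈ Ico 0 (2 * Real.pi), F (t : AddCircle (2 * Real.pi)) = δ t := fun t ht =>
    AddCircle.liftIco_zero_coe_apply ht
  let e := AddCircle.homeomorphCircle'
  have hFi : Function.Injective F := by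
    intro u v huv
    obtain ⟨t, ht, rfl⟩ := hrep u
    obtain ⟨t', ht', rfl⟩ := hrep v
    rw [hFc t ht, hFc t' ht'] at huv
    rw [hδi ht ht' huv]
  refine ⟨fun w => F (e.symm w), hF.comp e.symm.continuous, hFi.comp e.symm.injective, ?_⟩
  ext z
  constructor
  · rintro ⟨w, rfl⟩
    obtain ⟨t, ht, hw⟩ := hrep (e.symm w)
    simp only [← hw, hFc t ht]
    exact ⟨_, hmIcc (Ico_subset_Icc_self ht), rfl⟩
  · rintro ⟨s, hs, rfl⟩
    rcases hs.2.eq_or_lt with rfl | hlt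
    · refine ⟨e ((0 : ℝ) : AddCircle (2 * Real.pi)), ?_⟩
      simp only [Homeomorph.symm_apply_apply]
      rw [hFc 0 ⟨le_rfl, hp⟩, ← he]
      simp [hδ]
    · have ht : (s - a) / (b - a) * (2 * Real.pi) ∈ Ico 0 (2 * Real.pi) := by
        refine ⟨mul_nonneg (div_nonneg (by linarith [hs.1]) hba.le) hp.le, ?_⟩
        have : (s - a) / (b - a) < 1 := (div_lt_one hba).2 (by linarith)
        nlinarith
      refine ⟨e (((s - a) / (b - a) * (2 * Real.pi) : ℝ) : AddCircle (2 * Real.pi)), ?_⟩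
      simp only [Homeomorph.symm_apply_apply]
      rw [hFc _ ht]
      simp only [hδ]
      congr 1
      field_simp
      ring

/-- Every point of `X` has arbitrarily small arcs in `X` to all points of `X` close to it. -/
def LocallyArcConnectedAt (X : Set ℂ) (x : ℂ) : Prop :=
  ∀ δ > 0, ∃ η > 0, ∀ y ∈ X, dist y x < η → ArcJoined (X ∩ Metric.ball x δ) x y

/-- The graph of the logarithms of `h` over `X`, a covering space of `X` if `h` is continuous and
without zeros. -/
def logGraph (h : ℂ → ℂ) (X : Set ℂ) : Set (ℂ × ℂ) :=
  {p | p.1 ∈ X ∧ Complex.exp p.2 = h p.1}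

/-- If an arc in the graph of the logarithms joins two different points over the same point, then
its shadow contains a Jordan curve. -/
lemma exists_isJordan_of_arcJoined {h : ℂ → ℂ} {X : Set ℂ} {x l l' : ℂ}
    (hj : ArcJoined (logGraph h X) (x, l) (x, l')) (hl : l ≠ l') : ∃ C ⊆ X, IsJordan C := by
  obtain ⟨a, b, γ, hab, hc, hi, hm, hγa, hγb⟩ := hj
  -- Two different logarithms of the same number have distance at least `1`.
  have hsep : ∀ s ∈ Icc a b, ∀ t ∈ Icc a b, (γ s).1 = (γ t).1 → (γ s).2 ≠ (γ t).2 →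
      1 ≤ ‖(γ s).2 - (γ t).2‖ := by
    intro s hs t ht h1 h2
    have h3 : Complex.exp (γ s).2 = Complex.exp (γ t).2 := by
      rw [(hm hs).2, (hm ht).2, h1]
    obtain ⟨n, hn⟩ := Complex.exp_eq_exp_iff_exists_int.1 h3
    have hn0 : n ≠ 0 := by rintro rfl; simp at hn; exact h2 hn
    have h4 : (1 : ℝ) ≤ |(n : ℝ)| := by exact_mod_cast Int.one_le_abs hn0
    rw [hn, add_sub_cancel_left]
    simp only [norm_mul, Complex.norm_intCast, Complex.norm_ofNat, Complex.norm_real,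
      Real.norm_eq_abs, Complex.norm_I, mul_one, abs_of_pos Real.pi_pos]
    nlinarith [Real.pi_gt_three]
  set P : Set (ℝ × ℝ) := (Icc a b ×ˢ Icc a b) ∩
    (fun p : ℝ × ℝ => (p.2 - p.1, (γ p.1).1 - (γ p.2).1, ‖(γ p.1).2 - (γ p.2).2‖)) ⁻¹'
      (Ici 0 ×ˢ {0} ×ˢ Ici 1) with hP
  have hPc : IsCompact P := by
    refine (isCompact_Icc.prod isCompact_Icc).of_isClosed_subset ?_ inter_subset_left
    have h1 : ContinuousOn (fun p : ℝ × ℝ => γ p.1) (Icc a b ×ˢ Icc a b) :=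
      hc.comp continuousOn_fst fun p hp => hp.1
    have h2 : ContinuousOn (fun p : ℝ × ℝ => γ p.2) (Icc a b ×ˢ Icc a b) :=
      hc.comp continuousOn_snd fun p hp => hp.2
    refine ContinuousOn.preimage_isClosed_of_isClosed ?_ (isClosed_Icc.prod isClosed_Icc)
      (isClosed_Ici.prod (isClosed_singleton.prod isClosed_Ici))
    exact (continuousOn_snd.sub continuousOn_fst).prodMk
      ((h1.fst.sub h2.fst).prodMk (h1.snd.sub h2.snd).norm)
  have hPm : ∀ s t, (s, t) ∈ P ↔ s ∈ Icc a b ∧ t ∈ Icc a b ∧ s ≤ t ∧ (γ s).1 = (γ t).1 ∧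
      1 ≤ ‖(γ s).2 - (γ t).2‖ := by
    intro s t
    simp only [hP, mem_inter_iff, mem_prod, mem_preimage, mem_Ici, sub_nonneg, mem_singleton_iff,
      sub_eq_zero]
    tauto
  have hab' : (a, b) ∈ P := by
    refine (hPm a b).2 ⟨left_mem_Icc.2 hab, right_mem_Icc.2 hab, hab, by rw [hγa, hγb], ?_⟩
    exact hsep a (left_mem_Icc.2 hab) b (right_mem_Icc.2 hab) (by rw [hγa, hγb])
      (by rw [hγa, hγb]; exact hl)
  obtain ⟨⟨s, t⟩, hst, hmin⟩ := hPc.exists_isMinOn ⟨_, hab'⟩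
    (f := fun p : ℝ × ℝ => p.2 - p.1) (by fun_prop)
  obtain ⟨hs, ht, hle, h1, h2⟩ := (hPm s t).1 hst
  have hlt : s < t := by
    refine lt_of_le_of_ne hle ?_
    rintro rfl
    simp at h2
    linarith
  have hsub : Icc s t ⊆ Icc a b := Icc_subset_Icc hs.1 ht.2
  -- By minimality the shadow of `[s, t]` closes up at the end points only.
  have hinj : ∀ u ∈ Icc s t, ∀ v ∈ Icc s t, u < v → (γ u).1 = (γ v).1 → u = s ∧ v = t := by
    intro u hu v hv huv huv1
    have h3 : (γ u).2 ≠ (γ v).2 := fun h => huv.ne (hi (hsub hu) (hsub hv) (Prod.ext huv1 h))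
    have h4 := hmin ((hPm u v).2 ⟨hsub hu, hsub hv, huv.le, huv1,
      hsep u (hsub hu) v (hsub hv) huv1 h3⟩)
    simp only [mem_ofPred_eq] at h4
    have := hu.1; have := hv.2
    exact ⟨by linarith, by linarith⟩
  refine ⟨(fun u => (γ u).1) '' Icc s t, ?_, isJordan_image_Icc hlt (hc.mono hsub).fst h1 ?_⟩
  · rintro _ ⟨u, hu, rfl⟩
    exact (hm (hsub hu)).1
  · intro u hu v hv huv
    rcases lt_trichotomy u v with h | h | h
    · exact absurd (hinj u (Ico_subset_Icc_self hu) v (Ico_subset_Icc_self hv) h huv).2 hv.2.ne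
    · exact h
    · exact absurd (hinj v (Ico_subset_Icc_self hv) u (Ico_subset_Icc_self hu) h huv.symm).2 hu.2.ne

/-- In a locally arcwise connected set without Jordan curves every continuous function without
zeros has a continuous logarithm. -/
lemma hasLogOn_of_no_isJordan {X : Set ℂ} (hX : ∀ x ∈ X, LocallyArcConnectedAt X x)
    (hno : ¬ ∃ C ⊆ X, IsJordan C) {h : ℂ → ℂ} (hh : ContinuousOn h X) (h0 : ∀ x ∈ X, h x ≠ 0) :
    HasLogOn h X := by
  classical
  -- Arcs in `X` lift locally.
  have hloc : ∀ x ∈ X, ∃ η > 0, (∀ y ∈ X, dist y x < η → h y / h x ∈ Complex.slitPlane) ∧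
      ∀ y ∈ X, dist y x < η → ∀ l, Complex.exp l = h x →
        ArcJoined (logGraph h X) (x, l) (y, l + Complex.log (h y / h x)) := by
    intro x hx
    have hcx : ContinuousWithinAt (fun y => h y / h x) X x := (hh x hx).div_const _
    have h1 : (fun y => h y / h x) ⁻¹' Complex.slitPlane ∈ 𝓝[X] x := by
      refine hcx (Complex.isOpen_slitPlane.mem_nhds ?_)
      simp [div_self (h0 x hx)]
    obtain ⟨δ, hδ, hδs⟩ := Metric.mem_nhdsWithin_iff.1 h1
    obtain ⟨η, hη, harc⟩ := hX x hx δ hδ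
    refine ⟨min η δ, lt_min hη hδ, fun y hy hyd => hδs ⟨hyd.trans_le (min_le_right _ _), hy⟩, ?_⟩
    intro y hy hyd l hl
    have hslit : ∀ w ∈ X ∩ Metric.ball x δ, h w / h x ∈ Complex.slitPlane :=
      fun w hw => hδs ⟨hw.2, hw.1⟩
    have := (harc y hy (hyd.trans_le (min_le_left _ _))).map (U := logGraph h X)
      (φ := fun w => (w, l + Complex.log (h w / h x))) ?_ ?_ ?_
    · simpa [div_self (h0 x hx)] using this
    · refine continuousOn_id.prodMk (continuousOn_const.add (ContinuousOn.clog ?_ hslit))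
      exact (hh.mono inter_subset_left).div_const _
    · exact fun w _ w' _ hww => congrArg Prod.fst hww
    · intro w hw
      refine ⟨hw.1, ?_⟩
      simp only
      rw [Complex.exp_add, Complex.exp_log (Complex.slitPlane_ne_zero (hslit w hw)), hl]
      field_simp [h0 x hx]
  have htrans : ∀ {x y l l' c : ℂ}, Complex.exp c = 1 → ArcJoined (logGraph h X) (x, l) (y, l') →
      ArcJoined (logGraph h X) (x, l + c) (y, l' + c) := by
    intro x y l l' c hc hj
    refine hj.map (φ := fun p : ℂ × ℂ => (p.1, p.2 + c)) (by fun_prop) ?_ ?_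
    · rintro ⟨u, v⟩ - ⟨u', v'⟩ - huv
      simpa using huv
    · rintro ⟨u, v⟩ ⟨hu, hv⟩
      exact ⟨hu, by simp only [Complex.exp_add, hc, mul_one]; exact hv⟩
  have hmem : ∀ {p q : ℂ × ℂ}, ArcJoined (logGraph h X) p q → Complex.exp p.2 = h p.1 := by
    rintro p q ⟨a, b, γ, hab, -, -, hm, rfl, -⟩
    exact (hm (left_mem_Icc.2 hab)).2
  let R : Setoid X :=
    { r := fun x y => ∃ l l', ArcJoined (logGraph h X) ((x : ℂ), l) ((y : ℂ), l')
      iseqv := by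
        refine ⟨fun x => ?_, ?_, ?_⟩
        · exact ⟨_, _, ArcJoined.refl ⟨x.2, Complex.exp_log (h0 x x.2)⟩⟩
        · rintro x y ⟨l, l', hj⟩
          exact ⟨l', l, hj.symm⟩
        · rintro x y z ⟨l, l', hj⟩ ⟨m, m', hj'⟩
          have hc : Complex.exp (l' - m) = 1 := by
            have e1 : Complex.exp l' = h y := hmem hj.symm
            have e2 : Complex.exp m = h y := hmem hj'
            rw [Complex.exp_sub, e1, e2, div_self (h0 y y.2)]
          have := htrans hc hj'
          rw [add_sub_cancel] at this
          exact ⟨_, _, hj.trans this⟩ }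
  let rep : X → X := fun x => (Quotient.mk R x).out
  have hrep : ∀ x : X, ∃ l, ArcJoined (logGraph h X) ((rep x : ℂ), Complex.log (h (rep x)))
      ((x : ℂ), l) := by
    intro x
    obtain ⟨l, l', hj⟩ : R.r (rep x) x := Quotient.exact (Quotient.out_eq (Quotient.mk R x))
    have hc : Complex.exp (Complex.log (h (rep x)) - l) = 1 := by
      have e1 : Complex.exp l = h (rep x) := hmem hj
      rw [Complex.exp_sub, e1, Complex.exp_log (h0 _ (rep x).2), div_self (h0 _ (rep x).2)]
    have := htrans hc hj
    rw [add_sub_cancel] at this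
    exact ⟨_, this⟩
  choose g hg using hrep
  have hexp : ∀ x : X, Complex.exp (g x) = h x := fun x => hmem (hg x).symm
  have hglob : ∀ x y : X, ∀ l, ArcJoined (logGraph h X) ((x : ℂ), g x) ((y : ℂ), l) →
      g y = l := by
    intro x y l hj
    have hxy : rep x = rep y := by
      have : Quotient.mk R x = Quotient.mk R y := Quotient.sound ⟨_, _, hj⟩
      simp only [rep, this]
    have h1 := (hg x).trans hj
    rw [hxy] at h1
    by_contra hne
    exact hno (exists_isJordan_of_arcJoined ((hg y).symm.trans h1) hne)
  refine ⟨fun z => if hz : z ∈ X then g ⟨z, hz⟩ else 0, ?_, ?_⟩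
  · intro x hx
    obtain ⟨η, hη, hslit, harc⟩ := hloc x hx
    have hev : ∀ᶠ y in 𝓝[X] x, dist y x < η :=
      mem_nhdsWithin_of_mem_nhds (Metric.ball_mem_nhds x hη)
    have hcont : ContinuousWithinAt (fun y => g ⟨x, hx⟩ + Complex.log (h y / h x)) X x := by
      refine continuousWithinAt_const.add (ContinuousWithinAt.clog ((hh x hx).div_const _) ?_)
      simp [div_self (h0 x hx)]
    refine hcont.congr_of_eventuallyEq ?_ ?_
    · filter_upwards [hev, self_mem_nhdsWithin] with y hy hyX
      rw [dif_pos hyX]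
      exact hglob ⟨x, hx⟩ ⟨y, hyX⟩ _ (harc y hyX hy _ (hexp _))
    · rw [dif_pos hx]
      simp [div_self (h0 x hx)]
  · intro z hz
    simp only [dif_pos hz]
    exact hexp _

/-! ### Short chords -/

/-- The form of the chordal property with constant `1 / 2` that is used: chords `[p, q]` of length
at most `r₀` span a connected subset of `Γ` whose points have distance at most `|p - q| / 2` from
the line through `p` and `q`. In the coordinate `(w - p) / (q - p)` this line is the real axis. -/
def ChordCondition (Γ : Set ℂ) (r₀ : ℝ) : Prop :=
  ∀ p ∈ Γ, ∀ q ∈ Γ, p ≠ q → dist p q ≤ r₀ → ∃ σ ⊆ Γ, IsPreconnected σ ∧ p ∈ σ ∧ q ∈ σ ∧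
    ∀ w ∈ σ, |((w - p) / (q - p)).im| ≤ 1 / 2

/-- A point `a` whose distance from `Γ` is more than half of a chord `[p, q]` escapes to infinity
along a ray perpendicular to the chord, so `w - a` has a logarithm on the loop formed by the chord
and the part `σ` of `Γ` that it spans. -/
lemma hasLogOn_sub_chord {σ : Set ℂ} {p q a : ℂ} {e : ℝ} (hpq : p ≠ q) (hd : dist p q < 2 * e)
    (hp : p ∈ σ) (hq : q ∈ σ) (hσ : ∀ w ∈ σ, |((w - p) / (q - p)).im| ≤ 1 / 2)
    (ha : ∀ w ∈ σ, e ≤ dist w a) : HasLogOn (fun w => w - a) (σ ∪ segment ℝ p q) := by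
  have hqp : q - p ≠ 0 := sub_ne_zero.2 hpq.symm
  have hnorm : ‖q - p‖ < 2 * e := by rwa [← dist_eq_norm, dist_comm]
  have hnpos : 0 < ‖q - p‖ := norm_pos_iff.2 hqp
  set A := (a - p) / (q - p) with hA
  have hTA : ∀ w, (w - p) / (q - p) - A = (w - a) / (q - p) := fun w => by rw [hA]; ring
  -- The two facts that keep a perpendicular ray from `a` off the loop.
  have h1 : ∀ w ∈ σ, 1 / 2 < ‖(w - p) / (q - p) - A‖ := by
    intro w hw
    have h3 := ha w hw
    rw [dist_eq_norm] at h3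
    rw [hTA, norm_div, lt_div_iff₀ hnpos]
    linarith
  have h2 : ∀ w ∈ segment ℝ p q, ((w - p) / (q - p)).im = 0 ∧ (w - p) / (q - p) ≠ A := by
    intro w hw
    rw [segment_eq_image'] at hw
    obtain ⟨s, hs, rfl⟩ := hw
    have hT : (p + s • (q - p) - p) / (q - p) = (s : ℂ) := by
      rw [add_sub_cancel_left, Complex.real_smul, mul_div_cancel_right₀ _ hqp]
    rw [hT]
    refine ⟨Complex.ofReal_im s, fun h => ?_⟩
    have hp1 := h1 p hp
    have hq1 := h1 q hq
    rw [← h] at hp1 hq1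
    simp only [sub_self, zero_div, zero_sub, norm_neg, Complex.norm_real, Real.norm_eq_abs,
      div_self hqp] at hp1 hq1
    rw [abs_of_nonneg hs.1] at hp1
    have : ‖(1 : ℂ) - (s : ℂ)‖ = 1 - s := by
      rw [← Complex.ofReal_one, ← Complex.ofReal_sub, Complex.norm_real, Real.norm_eq_abs,
        abs_of_nonneg (by linarith [hs.2])]
    linarith
  obtain ⟨κ, hκ0, hκ⟩ : ∃ κ : ℂ, κ ≠ 0 ∧
      ∀ w ∈ σ ∪ segment ℝ p q, κ * ((w - p) / (q - p) - A) ∈ Complex.slitPlane := by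
    rcases le_total 0 A.im with h | h
    · refine ⟨Complex.I, Complex.I_ne_zero, fun w hw => ?_⟩
      rw [Complex.mem_slitPlane_iff]
      by_contra! hcon
      simp only [Complex.mul_re, Complex.I_re, zero_mul, Complex.I_im, one_mul, zero_sub,
        Complex.mul_im, zero_add, Complex.sub_im, Complex.sub_re] at hcon
      obtain ⟨hc1, hc2⟩ := hcon
      rcases hw with hw | hw
      · have h3 := h1 w hw
        rw [← Complex.abs_im_eq_norm.2 (by simpa using hc2), Complex.sub_im] at h3
        have h4 := (abs_le.1 (hσ w hw)).2
        rw [abs_of_nonneg (by linarith)] at h3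
        linarith
      · obtain ⟨h3, h4⟩ := h2 w hw
        exact h4 (Complex.ext (by linarith) (by linarith))
    · refine ⟨-Complex.I, neg_ne_zero.2 Complex.I_ne_zero, fun w hw => ?_⟩
      rw [Complex.mem_slitPlane_iff]
      by_contra! hcon
      simp only [Complex.mul_re, Complex.neg_re, Complex.I_re, zero_mul, Complex.neg_im,
        Complex.I_im, neg_mul, one_mul, zero_sub, Complex.mul_im, zero_add,
        Complex.sub_im, Complex.sub_re, neg_sub] at hcon
      obtain ⟨hc1, hc2⟩ := hcon
      rcases hw with hw | hw
      · have h3 := h1 w hw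
        rw [← Complex.abs_im_eq_norm.2 (by simp; linarith), Complex.sub_im] at h3
        have h4 := (abs_le.1 (hσ w hw)).1
        rw [abs_of_nonpos (by linarith)] at h3
        linarith
      · obtain ⟨h3, h4⟩ := h2 w hw
        exact h4 (Complex.ext (by linarith) (by linarith))
  refine ⟨fun w => Complex.log (κ * ((w - p) / (q - p) - A)) + Complex.log ((q - p) / κ),
    (ContinuousOn.clog (by fun_prop) hκ).add continuousOn_const, fun w hw => ?_⟩
  rw [Complex.exp_add, Complex.exp_log (Complex.slitPlane_ne_zero (hκ w hw)),
    Complex.exp_log (div_ne_zero hqp hκ0), hTA]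
  field_simp

lemma div_mem_slitPlane {a p w : ℂ} (h : dist w p < dist p a) :
    (w - a) / (p - a) ∈ Complex.slitPlane := by
  have hpa : 0 < ‖p - a‖ := by rw [← dist_eq_norm]; exact dist_nonneg.trans_lt h
  have h1 : (w - a) / (p - a) = 1 + (w - p) / (p - a) := by
    have := norm_pos_iff.1 hpa
    field_simp; ring
  rw [h1]
  refine Complex.mem_slitPlane_of_norm_lt_one ?_
  rw [norm_div, div_lt_one hpa, ← dist_eq_norm, ← dist_eq_norm]
  exact h

/-- The increment of the logarithm of `(z - a) / (z - b)` along the segment from `p` to `w`. -/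
noncomputable def logIncr (a b p w : ℂ) : ℂ :=
  Complex.log ((w - a) / (p - a)) - Complex.log ((w - b) / (p - b))

lemma continuousOn_logIncr {a b p : ℂ} {e : ℝ} (ha : e ≤ dist p a) (hb : e ≤ dist p b) :
    ContinuousOn (logIncr a b p) (Metric.ball p e) := by
  refine ContinuousOn.sub ?_ ?_
  · exact ContinuousOn.clog (by fun_prop) fun w hw =>
      div_mem_slitPlane ((Metric.mem_ball.1 hw).trans_le ha)
  · exact ContinuousOn.clog (by fun_prop) fun w hw =>
      div_mem_slitPlane ((Metric.mem_ball.1 hw).trans_le hb)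

lemma exp_logIncr {a b p w : ℂ} (ha : dist w p < dist p a) (hb : dist w p < dist p b) :
    Complex.exp (logIncr a b p w) = ((w - a) / (w - b)) / ((p - a) / (p - b)) := by
  have h1 := Complex.slitPlane_ne_zero (div_mem_slitPlane ha)
  have h2 := Complex.slitPlane_ne_zero (div_mem_slitPlane hb)
  rw [logIncr, Complex.exp_sub, Complex.exp_log h1, Complex.exp_log h2]
  rw [div_ne_zero_iff] at h1 h2
  have := h1.1; have := h1.2; have := h2.1; have := h2.2
  field_simp

/-- The logarithm of `(z - a) / (z - b)` on `Γ` extends consistently along the radii of the discs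
about points of `Γ` that contain neither `a` nor `b`. -/
lemma add_logIncr_eq {Γ : Set ℂ} {r₀ e : ℝ} (hΓ : ChordCondition Γ r₀) (he : 2 * e ≤ r₀)
    {a b : ℂ} (ha : ∀ w ∈ Γ, e ≤ dist w a) (hb : ∀ w ∈ Γ, e ≤ dist w b) {g : ℂ → ℂ}
    (hg : ContinuousOn g Γ) (hge : ∀ w ∈ Γ, Complex.exp (g w) = (w - a) / (w - b)) {p q z : ℂ}
    (hp : p ∈ Γ) (hq : q ∈ Γ) (hzp : dist z p < e) (hzq : dist z q < e) :
    g p + logIncr a b p z = g q + logIncr a b q z := by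
  rcases eq_or_ne p q with rfl | hpq
  · rfl
  have hd : dist p q < 2 * e := by
    have := dist_triangle_left p q z
    linarith
  obtain ⟨σ, hσΓ, hσc, hpσ, hqσ, hσ⟩ := hΓ p hp q hq hpq (hd.le.trans he)
  obtain ⟨ka, hka, hkae⟩ := hasLogOn_sub_chord hpq hd hpσ hqσ hσ fun w hw => ha w (hσΓ hw)
  obtain ⟨kb, hkb, hkbe⟩ := hasLogOn_sub_chord hpq hd hpσ hqσ hσ fun w hw => hb w (hσΓ hw)
  have hne : ∀ {w c : ℂ}, 0 < dist w c → w - c ≠ 0 := fun h => sub_ne_zero.2 (dist_pos.1 h)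
  have he0 : 0 < e := dist_nonneg.trans_lt hzp
  have hk : ∀ w ∈ σ ∪ segment ℝ p q, Complex.exp (ka w - kb w) = (w - a) / (w - b) :=
    fun w hw => by rw [Complex.exp_sub, hkae w hw, hkbe w hw]
  have hkc : ContinuousOn (fun w => ka w - kb w) (σ ∪ segment ℝ p q) := hka.sub hkb
  -- On `σ` the logarithms `g` and `ka - kb` differ by a constant.
  have e1 : g p - (ka p - kb p) = g q - (ka q - kb q) := by
    have hexp : ∀ w ∈ σ, Complex.exp (g w - (ka w - kb w)) = 1 := by
      intro w hw
      rw [Complex.exp_sub, hge w (hσΓ hw), hk w (Or.inl hw), div_self]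
      exact div_ne_zero (hne (he0.trans_le (ha w (hσΓ hw)))) (hne (he0.trans_le (hb w (hσΓ hw))))
    exact eq_of_exp_eq hσc (k := fun w => g w - (ka w - kb w))
      ((hg.mono hσΓ).sub (hkc.mono subset_union_left))
      (fun z hz w hw => by rw [hexp z hz, hexp w hw]) hpσ hqσ
  -- On either half of the chord the same holds for `ka - kb` and `logIncr`.
  have e2 : ∀ c ∈ σ, segment ℝ c (midpoint ℝ p q) ⊆ segment ℝ p q →
      segment ℝ c (midpoint ℝ p q) ⊆ Metric.ball c e →
      (ka c - kb c) + logIncr a b c (midpoint ℝ p q) =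
        ka (midpoint ℝ p q) - kb (midpoint ℝ p q) := by
    intro c hc hsub hball
    have hca := ha c (hσΓ hc)
    have hcb := hb c (hσΓ hc)
    have hexp : ∀ w ∈ segment ℝ c (midpoint ℝ p q),
        Complex.exp (ka w - kb w - logIncr a b c w) = (c - a) / (c - b) := by
      intro w hw
      have hwc := Metric.mem_ball.1 (hball hw)
      have hwa := hwc.trans_le hca
      have hwb := hwc.trans_le hcb
      rw [Complex.exp_sub, hk w (Or.inr (hsub hw)), exp_logIncr hwa hwb]
      have h1 := Complex.slitPlane_ne_zero (div_mem_slitPlane hwa)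
      have h2 := Complex.slitPlane_ne_zero (div_mem_slitPlane hwb)
      rw [div_ne_zero_iff] at h1 h2
      have := h1.1; have := h1.2; have := h2.1; have := h2.2
      field_simp
    have := eq_of_exp_eq (convex_segment c (midpoint ℝ p q)).isPreconnected
      (k := fun w => ka w - kb w - logIncr a b c w)
      ((hkc.mono (hsub.trans subset_union_right)).sub
        ((continuousOn_logIncr hca hcb).mono hball))
      (fun z hz w hw => by rw [hexp z hz, hexp w hw]) (left_mem_segment ℝ _ _)
      (right_mem_segment ℝ _ _)
    have h0 : logIncr a b c c = 0 := by
      simp [logIncr, div_self (hne (he0.trans_le hca)), div_self (hne (he0.trans_le hcb))]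
    simp only [h0, sub_zero] at this
    rw [this]; ring
  have hmp : dist (midpoint ℝ p q) p < e := by
    rw [dist_midpoint_left]; norm_num; linarith
  have hmq : dist (midpoint ℝ p q) q < e := by
    rw [dist_midpoint_right]; norm_num; linarith
  have hmm : midpoint ℝ p q ∈ segment ℝ p q := midpoint_mem_segment p q
  have e3 := e2 p hpσ ((convex_segment p q).segment_subset (left_mem_segment ℝ _ _) hmm)
    ((convex_ball p e).segment_subset (Metric.mem_ball_self he0) hmp)
  have e4 := e2 q hqσ ((convex_segment p q).segment_subset (right_mem_segment ℝ _ _) hmm)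
    ((convex_ball q e).segment_subset (Metric.mem_ball_self he0) hmq)
  -- The increments from `p` and from `q` differ by a constant on the intersection of the discs.
  have e5 : logIncr a b p z - logIncr a b q z =
      logIncr a b p (midpoint ℝ p q) - logIncr a b q (midpoint ℝ p q) := by
    have hexp : ∀ w ∈ Metric.ball p e ∩ Metric.ball q e,
        Complex.exp (logIncr a b p w - logIncr a b q w) =
          ((q - a) / (q - b)) / ((p - a) / (p - b)) := by
      rintro w ⟨hwp, hwq⟩
      have hpa := (Metric.mem_ball.1 hwp).trans_le (ha p hp)
      have hpb := (Metric.mem_ball.1 hwp).trans_le (hb p hp)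
      have hqa := (Metric.mem_ball.1 hwq).trans_le (ha q hq)
      have hqb := (Metric.mem_ball.1 hwq).trans_le (hb q hq)
      rw [Complex.exp_sub, exp_logIncr hpa hpb, exp_logIncr hqa hqb]
      have h1 := Complex.slitPlane_ne_zero (div_mem_slitPlane hpa)
      have h2 := Complex.slitPlane_ne_zero (div_mem_slitPlane hpb)
      have h3 := Complex.slitPlane_ne_zero (div_mem_slitPlane hqa)
      have h4 := Complex.slitPlane_ne_zero (div_mem_slitPlane hqb)
      rw [div_ne_zero_iff] at h1 h2 h3 h4
      have := h1.1; have := h1.2; have := h2.1; have := h2.2; have := h3.2; have := h4.2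
      field_simp
    exact eq_of_exp_eq ((convex_ball p e).inter (convex_ball q e)).isPreconnected
      (k := fun w => logIncr a b p w - logIncr a b q w)
      (((continuousOn_logIncr (ha p hp) (hb p hp)).mono inter_subset_left).sub
        ((continuousOn_logIncr (ha q hq) (hb q hq)).mono inter_subset_right))
      (fun z hz w hw => by rw [hexp z hz, hexp w hw]) ⟨hzp, hzq⟩ ⟨hmp, hmq⟩
  linear_combination e1 + e3 - e4 + e5

/-- Two points at distance at least `e` from `Γ` in the same component of the complement of `Γ` are
not separated by any subset of the open `e`-neighbourhood of `Γ`. -/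
lemma hasLogOn_infDist_lt {Γ : Set ℂ} (hne : Γ.Nonempty) {r₀ e : ℝ} (hΓ : ChordCondition Γ r₀)
    (he : 2 * e ≤ r₀) {a b : ℂ} (ha : ∀ w ∈ Γ, e ≤ dist w a) (hb : ∀ w ∈ Γ, e ≤ dist w b)
    (hlog : HasLogOn (fun w => (w - a) / (w - b)) Γ) :
    HasLogOn (fun w => (w - a) / (w - b)) {z | Metric.infDist z Γ < e} := by
  obtain ⟨g, hg, hge⟩ := hlog
  have hnear : ∀ z : ℂ, ∃ p : ℂ, Metric.infDist z Γ < e → p ∈ Γ ∧ dist z p < e := by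
    intro z
    by_cases hz : Metric.infDist z Γ < e
    · obtain ⟨p, hp, hpz⟩ := (Metric.infDist_lt_iff hne).1 hz
      exact ⟨p, fun _ => ⟨hp, hpz⟩⟩
    · exact ⟨0, fun h => absurd h hz⟩
  choose π hπ using hnear
  refine ⟨fun z => g (π z) + logIncr a b (π z) z, ?_, ?_⟩
  · intro z hz
    obtain ⟨hp, hpz⟩ := hπ z hz
    have hball : Metric.ball (π z) e ∈ 𝓝 z := Metric.isOpen_ball.mem_nhds hpz
    have hc : ContinuousAt (fun w => g (π z) + logIncr a b (π z) w) z :=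
      continuousAt_const.add
        ((continuousOn_logIncr (ha _ hp) (hb _ hp)).continuousAt hball)
    refine hc.continuousWithinAt.congr_of_eventuallyEq ?_ rfl
    filter_upwards [mem_nhdsWithin_of_mem_nhds hball, self_mem_nhdsWithin] with w hw hwe
    obtain ⟨hp', hpw⟩ := hπ w hwe
    exact add_logIncr_eq hΓ he ha hb hg hge hp' hp hpw hw
  · intro z hz
    obtain ⟨hp, hpz⟩ := hπ z hz
    have h1 := div_mem_slitPlane (hpz.trans_le (ha _ hp))
    have h2 := div_mem_slitPlane (hpz.trans_le (hb _ hp))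
    rw [Complex.exp_add, hge _ hp, exp_logIncr (hpz.trans_le (ha _ hp)) (hpz.trans_le (hb _ hp))]
    have h1 := Complex.slitPlane_ne_zero h1
    have h2 := Complex.slitPlane_ne_zero h2
    rw [div_ne_zero_iff] at h1 h2
    have := h1.1; have := h1.2; have := h2.1; have := h2.2
    field_simp

/-- If two points of `Γ` on the circle of radius `e` about `x` are antipodal and `Γ` does not enter
the disc, then one of the two points in perpendicular direction is in `Γ` as well: the part of `Γ`
spanned by the chord has to pass through the perpendicular bisector. -/
lemma exists_perp_of_antipodal {Γ : Set ℂ} {r₀ e : ℝ} (hΓ : ChordCondition Γ r₀) (he0 : 0 < e)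
    (he : 2 * e ≤ r₀) {x : ℂ} (hx : ∀ w ∈ Γ, e ≤ dist w x) {p q : ℂ} (hp : p ∈ Γ) (hq : q ∈ Γ)
    (hpx : dist p x = e) (hanti : q - x = -(p - x)) :
    x + Complex.I * (p - x) ∈ Γ ∨ x - Complex.I * (p - x) ∈ Γ := by
  by_contra! hcon
  have hpx0 : p - x ≠ 0 := by
    rw [← norm_pos_iff, ← dist_eq_norm, hpx]; exact he0
  have hqp : q - p = -2 * (p - x) := by linear_combination hanti
  have hpq : p ≠ q := fun h => by
    rw [h, sub_self] at hqp
    rw [h] at hpx0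
    simp [hpx0] at hqp
  have hd : dist p q ≤ r₀ := by
    rw [dist_comm, dist_eq_norm, hqp, norm_mul, ← dist_eq_norm, hpx]
    simpa using he
  obtain ⟨σ, hσΓ, hσc, hpσ, hqσ, hσ⟩ := hΓ p hp q hq hpq hd
  have hre : ∀ w ∈ σ, ((w - x) / (p - x)).re ≠ 0 := by
    intro w hw h0
    set y := (w - x) / (p - x) with hy
    have hwy : w = x + y * (p - x) := by rw [hy]; field_simp; ring
    have h1 : |y.im| ≤ 1 := by
      have h2 := hσ w hw
      have h3 : (w - p) / (q - p) = (1 - y) / 2 := by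
        rw [hqp, hwy]; field_simp; ring
      rw [h3] at h2
      have h4 : ((1 - y) / 2).im = - y.im / 2 := by
        simp
      rw [h4, abs_div, abs_neg, abs_two] at h2
      linarith
    have h2 : 1 ≤ |y.im| := by
      rw [Complex.abs_im_eq_norm.2 h0, hy, norm_div, ← dist_eq_norm, ← dist_eq_norm, hpx,
        one_le_div he0]
      exact hx w (hσΓ hw)
    have h3 : |y.im| = 1 := le_antisymm h1 h2
    rcases (abs_eq one_pos.le).1 h3 with h | h
    · refine hcon.1 ?_
      have : y = Complex.I := Complex.ext (by simpa using h0) (by simpa using h)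
      rw [← this, ← hwy]; exact hσΓ hw
    · refine hcon.2 ?_
      have : y = -Complex.I := Complex.ext (by simpa using h0) (by simpa using h)
      have h5 : w = x - Complex.I * (p - x) := by rw [hwy, this]; ring
      rw [← h5]; exact hσΓ hw
  have hivt := hσc.intermediate_value hqσ hpσ
    (f := fun w => ((w - x) / (p - x)).re) (by fun_prop)
  have h0 : (0 : ℝ) ∈ Icc ((q - x) / (p - x)).re ((p - x) / (p - x)).re := by
    rw [hanti, neg_div, div_self hpx0]
    simp
  obtain ⟨w, hw, hw0⟩ := hivt h0
  exact hre w hw hw0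

/-- All nearest points of `x` on `Γ` lie on an open half circle about `x`. The half circle is the
left one in the coordinate `(n - x) / v`. -/
def IsRegularPoint (Γ : Set ℂ) (e : ℝ) (x : ℂ) : Prop :=
  ∃ v : ℂ, ‖v‖ = e ∧ ∀ n ∈ Γ, dist n x = e → ((n - x) / v).re < 0

/-- All nearest points of `x` on `Γ` lie on a closed half circle about `x` that contains its end
points and its midpoint. The half circle is the lower one in the coordinate `(n - x) / v`. -/
def IsCriticalPoint (Γ : Set ℂ) (e : ℝ) (x : ℂ) : Prop :=
  ∃ v : ℂ, ‖v‖ = e ∧ (∀ n ∈ Γ, dist n x = e → ((n - x) / v).im ≤ 0) ∧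
    x + v ∈ Γ ∧ x - v ∈ Γ ∧ x - Complex.I * v ∈ Γ

/-- The logarithm of `(w - x) / (w - b)` on `Γ` provides a branch of the angle at which the nearest
points of `x` are seen from `x`. By the chord condition this angle varies by at most `π`. -/
lemma isRegularPoint_or_isCriticalPoint {Γ : Set ℂ} (hcpt : IsCompact Γ) {r₀ e : ℝ}
    (hΓ : ChordCondition Γ r₀) (he0 : 0 < e) (he : 2 * e ≤ r₀) {x b : ℂ}
    (hx : ∀ w ∈ Γ, e ≤ dist w x) (hb : ∀ w ∈ Γ, e < dist w b)
    (hlog : HasLogOn (fun w => (w - x) / (w - b)) Γ) :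
    IsRegularPoint Γ e x ∨ IsCriticalPoint Γ e x := by
  obtain ⟨g, hg, hge⟩ := hlog
  set N : Set ℂ := Γ ∩ Metric.sphere x e with hN
  have hNc : IsCompact N := hcpt.inter_right Metric.isClosed_sphere
  have hmem : ∀ n, n ∈ N ↔ n ∈ Γ ∧ dist n x = e := fun n => Iff.rfl
  rcases N.eq_empty_or_nonempty with hNe | hNne
  · refine Or.inl ⟨e, by simp [abs_of_pos he0], fun n hn hnx => ?_⟩
    have : n ∈ N := ⟨hn, hnx⟩
    rw [hNe] at this
    exact this.elim
  have hN0 : ∀ n ∈ N, n - x ≠ 0 := fun n hn => by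
    rw [← norm_pos_iff, ← dist_eq_norm, hn.2]; exact he0
  have hxb : ∀ n ∈ N, (x - b) / (n - b) ∈ Complex.slitPlane := by
    intro n hn
    refine div_mem_slitPlane ?_
    rw [dist_comm x n, hn.2]
    exact hb n hn.1
  set u : ℂ → ℂ := fun n => g n - Complex.log ((x - b) / (n - b)) with hu
  have huc : ContinuousOn u N := by
    refine (hg.mono inter_subset_left).sub (ContinuousOn.clog ?_ hxb)
    refine continuousOn_const.div (by fun_prop) fun n hn h => ?_
    have := Complex.slitPlane_ne_zero (hxb n hn)
    rw [h, div_zero] at this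
    exact this rfl
  have hue : ∀ n ∈ N, Complex.exp (u n) = (n - x) / (x - b) := by
    intro n hn
    have h1 := Complex.slitPlane_ne_zero (hxb n hn)
    rw [hu, Complex.exp_sub, hge n hn.1, Complex.exp_log h1]
    rw [div_ne_zero_iff] at h1
    have := h1.1; have := h1.2
    field_simp
  have hxb0 : ∀ n ∈ N, x - b ≠ 0 := fun n hn =>
    (div_ne_zero_iff.1 (Complex.slitPlane_ne_zero (hxb n hn))).1
  set θ : ℂ → ℝ := fun n => (u n).im with hθ
  have hexp : ∀ p ∈ N, ∀ q ∈ N,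
      Complex.exp ((θ p - θ q : ℝ) * Complex.I) = (p - x) / (q - x) := by
    intro p hp q hq
    have h1 : Complex.exp (u p - u q) = (p - x) / (q - x) := by
      rw [Complex.exp_sub, hue p hp, hue q hq]
      have := hN0 q hq; have := hxb0 p hp
      field_simp
    have h2 : (u p - u q).re = 0 := by
      have h3 := congrArg norm h1
      rw [Complex.norm_exp, norm_div, ← dist_eq_norm, ← dist_eq_norm, hp.2, hq.2, div_self he0.ne',
        Real.exp_eq_one_iff] at h3
      exact h3
    rw [← h1]
    congr 1
    apply Complex.ext
    · rw [h2]; simp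
    · simp [hθ]
  have hna : ∀ p ∈ N, ∀ q ∈ N, q - x ≠ -(p - x) → |θ p - θ q| < Real.pi := by
    intro p hp q hq hne
    have hp0 := hN0 p hp
    have hq0 := hN0 q hq
    have hmm : dist (midpoint ℝ p q) p < e ∧ dist (midpoint ℝ p q) q < e := by
      have h1 := parallelogram_law_with_norm ℝ (p - x) (q - x)
      rw [← dist_eq_norm p x, ← dist_eq_norm q x, hp.2, hq.2] at h1
      have h2 : 0 < ‖p - x + (q - x)‖ := by
        rw [norm_pos_iff]
        intro h
        exact hne (by linear_combination h)
      have h3 : p - x - (q - x) = p - q := by ring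
      rw [h3] at h1
      have h4 : ‖p - q‖ < 2 * e := by nlinarith [norm_nonneg (p - q)]
      rw [dist_midpoint_left, dist_midpoint_right, dist_eq_norm]
      norm_num
      linarith
    set m := midpoint ℝ p q with hm
    have hm' : m = (p + q) / 2 := by
      rw [hm, midpoint_eq_smul_add, Complex.real_smul, invOf_eq_inv]; push_cast; ring
    have e1 := add_logIncr_eq hΓ he hx (fun w hw => (hb w hw).le) hg hge hp.1 hq.1 hmm.1 hmm.2
    -- The increments of the logarithm of `w - b` are unchanged when `m` is replaced by `x`.
    have e2 : Complex.log ((m - b) / (p - b)) - Complex.log ((m - b) / (q - b)) =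
        Complex.log ((x - b) / (p - b)) - Complex.log ((x - b) / (q - b)) := by
      have hslit : ∀ n ∈ N, ∀ w ∈ Metric.closedBall n e, (w - b) / (n - b) ∈ Complex.slitPlane :=
        fun n hn w hw => div_mem_slitPlane ((Metric.mem_closedBall.1 hw).trans_lt (hb n hn.1))
      refine eq_of_exp_eq ((convex_closedBall p e).inter (convex_closedBall q e)).isPreconnected
        (k := fun w => Complex.log ((w - b) / (p - b)) - Complex.log ((w - b) / (q - b))) ?_ ?_
        ⟨hmm.1.le, hmm.2.le⟩ ⟨by rw [Metric.mem_closedBall, dist_comm, hp.2],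
          by rw [Metric.mem_closedBall, dist_comm, hq.2]⟩
      · refine ContinuousOn.sub ?_ ?_
        · exact ContinuousOn.clog (by fun_prop) fun w hw => hslit p hp w hw.1
        · exact ContinuousOn.clog (by fun_prop) fun w hw => hslit q hq w hw.2
      · have hconst : ∀ w ∈ Metric.closedBall p e ∩ Metric.closedBall q e,
            Complex.exp (Complex.log ((w - b) / (p - b)) - Complex.log ((w - b) / (q - b))) =
              (q - b) / (p - b) := by
          intro w hw
          have h1 := Complex.slitPlane_ne_zero (hslit p hp w hw.1)
          have h2 := Complex.slitPlane_ne_zero (hslit q hq w hw.2)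
          rw [Complex.exp_sub, Complex.exp_log h1, Complex.exp_log h2]
          rw [div_ne_zero_iff] at h1 h2
          have := h1.1; have := h1.2; have := h2.2
          field_simp
        exact fun z hz w hw => by rw [hconst z hz, hconst w hw]
    have e3 : u p + Complex.log ((m - x) / (p - x)) = u q + Complex.log ((m - x) / (q - x)) := by
      simp only [hu, logIncr] at e1 ⊢
      linear_combination e1 + e2
    have e4 : θ p - θ q = ((m - x) / (q - x)).arg - ((m - x) / (p - x)).arg := by
      have := congrArg Complex.im e3
      simp only [Complex.add_im, Complex.log_im] at this
      simp only [hθ]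
      linarith
    -- Both arguments are half of the angle between `p - x` and `q - x`.
    have hpos : ∀ p ∈ N, ∀ q ∈ N, q - x ≠ -(p - x) →
        |(((p + q) / 2 - x) / (p - x)).arg| < Real.pi / 2 := by
      intro p hp q hq hne
      have hp0 := hN0 p hp
      rw [Complex.abs_arg_lt_pi_div_two_iff]
      left
      have h1 : ((p + q) / 2 - x) / (p - x) = (1 + (q - x) / (p - x)) / 2 := by
        field_simp; ring
      set r := (q - x) / (p - x) with hr
      have h2 : ‖r‖ = 1 := by
        rw [hr, norm_div, ← dist_eq_norm, ← dist_eq_norm, hp.2, hq.2, div_self he0.ne']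
      have h3 : r ≠ -1 := by
        intro h
        rw [hr, div_eq_iff hp0] at h
        exact hne (by rw [h]; ring)
      have h4 : -1 < r.re := by
        rcases (neg_le_of_abs_le ((Complex.abs_re_le_norm r).trans h2.le)).eq_or_lt with h | h
        · refine absurd (Complex.ext h.symm ?_) h3
          have h5 := Complex.sq_norm_sub_sq_re r
          rw [h2, ← h] at h5
          simpa using h5.symm
        · exact h
      rw [h1]
      simp
      linarith
    have h5 := hpos p hp q hq hne
    have h6 := hpos q hq p hp (fun h => hne (by rw [h]; ring))
    rw [add_comm q p] at h6
    rw [← hm'] at h5 h6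
    rw [e4]
    rw [abs_lt] at *
    constructor <;> linarith [h5.1, h5.2, h6.1, h6.2]
  have hle : ∀ p ∈ N, ∀ q ∈ N, |θ p - θ q| ≤ Real.pi := by
    intro p hp q hq
    by_cases hanti : q - x = -(p - x)
    swap
    · exact (hna p hp q hq hanti).le
    have hp0 := hN0 p hp
    have hz : ∃ z ∈ N, z - x = Complex.I * (p - x) ∨ z - x = -(Complex.I * (p - x)) := by
      rcases exists_perp_of_antipodal hΓ he0 he hx hp.1 hq.1 hp.2 hanti with h | h
      · refine ⟨_, ⟨h, ?_⟩, Or.inl (by ring)⟩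
        have := hp.2
        simpa [dist_eq_norm] using this
      · refine ⟨_, ⟨h, ?_⟩, Or.inr (by ring)⟩
        have := hp.2
        simpa [dist_eq_norm] using this
    obtain ⟨z, hz, hzx⟩ := hz
    have hhalf : ∀ s ∈ N, (s - x = p - x ∨ s - x = -(p - x)) → |θ s - θ z| ≤ Real.pi / 2 := by
      intro s hs hsp
      have hz0 := hN0 z hz
      have hval : (s - x) / (z - x) = Complex.I ∨ (s - x) / (z - x) = -Complex.I := by
        have hI := Complex.I_mul_I
        rw [div_eq_iff hz0, div_eq_iff hz0]
        rcases hsp with h | h <;> rcases hzx with h' | h' <;> rw [h, h']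
        · right; linear_combination (p - x) * hI
        · left; linear_combination (p - x) * hI
        · left; linear_combination (-(p - x)) * hI
        · right; linear_combination (-(p - x)) * hI
      have hlt : |θ s - θ z| < Real.pi := by
        refine hna s hs z hz fun h => ?_
        have : (s - x) / (z - x) = -1 := by
          rw [h]; field_simp [hN0 s hs]
        rw [this] at hval
        rcases hval with h | h <;> simpa using congrArg Complex.re h
      have hcos : Real.cos (θ s - θ z) = 0 := by
        have h1 := congrArg Complex.re (hexp s hs z hz)
        rw [Complex.exp_ofReal_mul_I_re] at h1
        rw [h1]
        rcases hval with h | h <;> rw [h] <;> simp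
      by_contra! hgt
      rw [← Real.cos_abs] at hcos
      have := Real.cos_neg_of_pi_div_two_lt_of_lt hgt (by linarith [Real.pi_pos])
      linarith
    have h1 := hhalf p hp (Or.inl rfl)
    have h2 := hhalf q hq (Or.inr hanti)
    rw [abs_le] at *
    constructor <;> linarith [h1.1, h1.2, h2.1, h2.2]
  have hθc : ContinuousOn θ N := Complex.continuous_im.comp_continuousOn huc
  obtain ⟨p₀, hp₀, hmin⟩ := hNc.exists_isMinOn hNne hθc
  obtain ⟨p₁, hp₁, hmax⟩ := hNc.exists_isMaxOn hNne hθc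
  set μ := (θ p₀ + θ p₁) / 2 with hμ
  -- `M` points to the middle of the arc of nearest points.
  set M : ℂ := (p₀ - x) * Complex.exp ((μ - θ p₀ : ℝ) * Complex.I) with hM
  have hMn : ‖M‖ = e := by
    rw [hM, norm_mul, Complex.norm_exp_ofReal_mul_I, mul_one, ← dist_eq_norm, hp₀.2]
  have hM0 : M ≠ 0 := by rw [← norm_pos_iff, hMn]; exact he0
  have hMq : ∀ n ∈ N, (n - x) / M = Complex.exp ((θ n - μ : ℝ) * Complex.I) := by
    intro n hn
    have h1 : n - x = (p₀ - x) * Complex.exp ((θ n - θ p₀ : ℝ) * Complex.I) := by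
      rw [hexp n hn p₀ hp₀]
      field_simp [hN0 p₀ hp₀]
    rw [div_eq_iff hM0, h1, hM, mul_left_comm, ← Complex.exp_add]
    congr 2
    push_cast; ring
  have hlo : ∀ n ∈ N, θ p₀ ≤ θ n := fun n hn => hmin hn
  have hhi : ∀ n ∈ N, θ n ≤ θ p₁ := fun n hn => hmax hn
  have hrange := hle p₁ hp₁ p₀ hp₀
  rw [abs_of_nonneg (by linarith [hlo p₁ hp₁])] at hrange
  rcases hrange.lt_or_eq with hlt | heq
  · left
    refine ⟨-M, by rw [norm_neg, hMn], fun n hn hnx => ?_⟩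
    rw [div_neg, Complex.neg_re, hMq n ⟨hn, hnx⟩, Complex.exp_ofReal_mul_I_re, neg_lt_zero]
    have h1 := hlo n ⟨hn, hnx⟩
    have h2 := hhi n ⟨hn, hnx⟩
    exact Real.cos_pos_of_mem_Ioo ⟨by linarith, by linarith⟩
  · right
    have hI0 := Complex.I_ne_zero
    have hI := Complex.I_mul_I
    have hq0 : (p₀ - x) / M = -Complex.I := by
      rw [hMq p₀ hp₀, show θ p₀ - μ = -(Real.pi / 2) by linarith]
      push_cast
      rw [neg_mul, Complex.exp_neg, Complex.exp_pi_div_two_mul_I, Complex.inv_I]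
    have hq1 : (p₁ - x) / M = Complex.I := by
      rw [hMq p₁ hp₁, show θ p₁ - μ = Real.pi / 2 by linarith]
      push_cast
      rw [Complex.exp_pi_div_two_mul_I]
    rw [div_eq_iff hM0] at hq0 hq1
    have him : ∀ n ∈ Γ, dist n x = e → ((n - x) / (Complex.I * M)).im ≤ 0 := by
      intro n hn hnx
      have h1 := hlo n ⟨hn, hnx⟩
      have h2 := hhi n ⟨hn, hnx⟩
      have h3 : (n - x) / (Complex.I * M) = -Complex.I * ((n - x) / M) := by
        rw [mul_comm, ← div_div, div_eq_mul_inv _ Complex.I, Complex.inv_I]; ring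
      rw [h3, hMq n ⟨hn, hnx⟩]
      simp only [neg_mul, Complex.neg_im, Complex.mul_im, Complex.I_re, zero_mul, Complex.I_im,
        one_mul, zero_add, Complex.exp_ofReal_mul_I_re]
      rw [neg_nonpos]
      exact Real.cos_nonneg_of_mem_Icc ⟨by linarith, by linarith⟩
    refine ⟨Complex.I * M, by rw [norm_mul, Complex.norm_I, one_mul, hMn], him, ?_, ?_, ?_⟩
    · rw [← hq1, add_sub_cancel]; exact hp₁.1
    · have : x - Complex.I * M = p₀ := by linear_combination -hq0
      rw [this]; exact hp₀.1
    · have h1 : x - Complex.I * (Complex.I * M) = x - Complex.I * (p₁ - x) := by rw [hq1]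
      rcases exists_perp_of_antipodal hΓ he0 he hx hp₁.1 hp₀.1 hp₁.2
        (by rw [hq0, hq1]; ring) with h | h
      · exfalso
        rw [hq1] at h
        have h2 : x + Complex.I * (Complex.I * M) = x - M := by linear_combination M * hI
        rw [h2] at h
        have h3 := him _ h (by rw [dist_eq_norm]; simpa using hMn)
        have h4 : (x - M - x) / (Complex.I * M) = Complex.I := by
          rw [div_eq_iff (mul_ne_zero hI0 hM0)]
          linear_combination (-M) * hI
        rw [h4] at h3
        norm_num at h3
      · rw [h1]; exact h

/-! ### Local structure of the level sets of the distance function -/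

lemma exists_pos_le_of_isCompact {A : Set ℂ} (hA : IsCompact A) {f : ℂ → ℝ} (hf : Continuous f)
    (h : ∀ n ∈ A, 0 < f n) : ∃ κ > 0, ∀ n ∈ A, κ ≤ f n := by
  rcases A.eq_empty_or_nonempty with rfl | hne
  · exact ⟨1, one_pos, by simp⟩
  · obtain ⟨n, hn, hmin⟩ := hA.exists_isMinOn hne hf.continuousOn
    exact ⟨f n, h n hn, fun m hm => hmin hm⟩

lemma dist_sq_eq (z w : ℂ) : dist z w ^ 2 = (z.re - w.re) ^ 2 + (z.im - w.im) ^ 2 := by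
  rw [Complex.dist_eq_re_im, Real.sq_sqrt (by positivity)]

lemma infDist_eq_one {A : Set ℂ} {z : ℂ} (h : ∀ n ∈ A, 1 ≤ dist z n)
    {n : ℂ} (hn : n ∈ A) (h1 : dist z n = 1) : Metric.infDist z A = 1 :=
  le_antisymm (h1 ▸ Metric.infDist_le_dist_of_mem hn) ((Metric.le_infDist ⟨n, hn⟩).2 h)

/-- If all nearest points of the origin lie in the left half plane, then the distance increases
to the right. -/
lemma exists_infDist_strictMono {A : Set ℂ} (hA : IsCompact A) (h1 : ∀ n ∈ A, 1 ≤ ‖n‖)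
    (hre : ∀ n ∈ A, ‖n‖ = 1 → n.re < 0) {n₀ : ℂ} (hn₀ : n₀ ∈ A) (hn₀1 : ‖n₀‖ = 1) :
    ∃ ρ > 0, ∀ (z : ℂ) (t : ℝ), ‖z‖ < ρ → 0 < t → ‖z + t‖ < ρ →
      Metric.infDist z A < Metric.infDist (z + t) A := by
  obtain ⟨κ, hκ, hκA⟩ := exists_pos_le_of_isCompact hA
    (f := fun n => max (‖n‖ - 1) (-n.re)) (by fun_prop) (by
      intro n hn
      rcases (h1 n hn).eq_or_lt with h | h
      · exact lt_max_of_lt_right (by linarith [hre n hn h.symm])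
      · exact lt_max_of_lt_left (by linarith))
  refine ⟨κ / 3, by positivity, fun z t hz ht hzt => ?_⟩
  obtain ⟨n, hn, hd⟩ := hA.exists_infDist_eq_dist ⟨n₀, hn₀⟩ (z + t)
  have h2 : dist (z + t) n ≤ 1 + ‖z + t‖ := by
    rw [← hd]
    refine (Metric.infDist_le_dist_of_mem hn₀).trans ?_
    rw [dist_eq_norm]
    exact (norm_sub_le _ _).trans (by rw [hn₀1]; linarith)
  have h3 : ‖n‖ ≤ dist (z + t) n + ‖z + t‖ := by
    have := norm_sub_norm_le n (z + t)
    rw [dist_comm, dist_eq_norm]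
    linarith
  have h4 : n.re ≤ -κ := by
    rcases le_max_iff.1 (hκA n hn) with h | h
    · linarith
    · linarith
  have h5 := (abs_le.1 ((Complex.abs_re_le_norm z).trans hz.le)).1
  rw [hd]
  refine (Metric.infDist_le_dist_of_mem hn).trans_lt ?_
  have h6 := dist_sq_eq z n
  have h7 := dist_sq_eq (z + t) n
  simp only [Complex.add_re, Complex.ofReal_re, Complex.add_im, Complex.ofReal_im, add_zero] at h7
  have h8 : dist z n ^ 2 < dist (z + t) n ^ 2 := by
    rw [h6, h7]
    nlinarith
  exact lt_of_pow_lt_pow_left₀ 2 dist_nonneg h8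

/-- The level set through the origin of a function that is strictly increasing in the real
direction is a graph over the imaginary axis. -/
lemma exists_graph {F : ℂ → ℝ} (hF : Continuous F) (h0 : F 0 = 1) {ρ : ℝ}
    (hmono : ∀ (z : ℂ) (t : ℝ), ‖z‖ < ρ → 0 < t → ‖z + t‖ < ρ → F z < F (z + t)) {τ : ℝ}
    (hτ0 : 0 < τ) (hτρ : τ ≤ ρ / 3) : ∃ (s₀ : ℝ) (T : ℝ → ℝ), 0 < s₀ ∧ s₀ ≤ τ ∧
      ContinuousOn T (Icc (-s₀) s₀) ∧ T 0 = 0 ∧ ∀ s ∈ Icc (-s₀) s₀, |T s| < τ ∧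
        ∀ t : ℝ, |t| ≤ τ → (F (t + s * Complex.I) < 1 ↔ t < T s) ∧
          (1 < F (t + s * Complex.I) ↔ T s < t) := by
  have hnorm : ∀ t s : ℝ, |t| ≤ τ → |s| ≤ ρ / 3 → ‖(t + s * Complex.I : ℂ)‖ < ρ := by
    intro t s ht hs
    refine (norm_add_le _ _).trans_lt ?_
    simp only [norm_mul, Complex.norm_real, Real.norm_eq_abs, Complex.norm_I, mul_one]
    linarith
  have hm : ∀ s : ℝ, |s| ≤ ρ / 3 → ∀ t t' : ℝ, |t| ≤ τ → |t'| ≤ τ → t < t' →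
      F (t + s * Complex.I) < F (t' + s * Complex.I) := by
    intro s hs t t' ht ht' htt
    have h1 : (t' + s * Complex.I : ℂ) = (t + s * Complex.I) + ((t' - t : ℝ) : ℂ) := by
      push_cast; ring
    rw [h1]
    exact hmono _ _ (hnorm t s ht hs) (by linarith) (by rw [← h1]; exact hnorm t' s ht' hs)
  have hτabs : |τ| ≤ τ := (abs_of_pos hτ0).le
  have hτabs' : |-τ| ≤ τ := by rw [abs_neg]; exact hτabs
  have hcont : Continuous fun p : ℝ × ℝ => F (p.1 + p.2 * Complex.I) := by fun_prop
  have hat0 : F ((0 : ℝ) + (0 : ℝ) * Complex.I) = 1 := by simpa using h0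
  have hlo : F ((-τ : ℝ) + (0 : ℝ) * Complex.I) < 1 := by
    rw [← hat0]
    exact hm 0 (by simp; linarith) _ _ hτabs' (by simpa using hτ0.le) (by linarith)
  have hhi : 1 < F ((τ : ℝ) + (0 : ℝ) * Complex.I) := by
    rw [← hat0]
    exact hm 0 (by simp; linarith) _ _ (by simpa using hτ0.le) hτabs hτ0
  have hev : ∀ᶠ s : ℝ in 𝓝 0, F ((-τ : ℝ) + s * Complex.I) < 1 ∧
      1 < F ((τ : ℝ) + s * Complex.I) := by
    have c1 : Continuous fun s : ℝ => F ((-τ : ℝ) + s * Complex.I) := by fun_prop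
    have c2 : Continuous fun s : ℝ => F ((τ : ℝ) + s * Complex.I) := by fun_prop
    exact (c1.continuousAt.eventually_lt continuousAt_const hlo).and
      (continuousAt_const.eventually_lt c2.continuousAt hhi)
  obtain ⟨s₁, hs₁, hs₁F⟩ := Metric.eventually_nhds_iff.1 hev
  set s₀ := min (s₁ / 2) τ with hs₀
  have hs₀0 : 0 < s₀ := lt_min (by linarith) hτ0
  have hs₀τ : s₀ ≤ τ := min_le_right _ _
  have hs₀ρ : s₀ ≤ ρ / 3 := hs₀τ.trans hτρ
  have hs₀1 : s₀ ≤ s₁ / 2 := min_le_left _ _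
  have hs : ∀ s ∈ Icc (-s₀) s₀, |s| ≤ ρ / 3 := fun s hs => (abs_le.2 hs).trans hs₀ρ
  have hex : ∀ s : ℝ, ∃ t : ℝ, s ∈ Icc (-s₀) s₀ → |t| < τ ∧ F (t + s * Complex.I) = 1 := by
    intro s
    by_cases hsI : s ∈ Icc (-s₀) s₀
    swap
    · exact ⟨0, fun h => absurd h hsI⟩
    have hends := hs₁F (show dist s 0 < s₁ by
      rw [Real.dist_0_eq_abs]; linarith [abs_le.2 hsI])
    have c : Continuous fun t : ℝ => F (t + s * Complex.I) := by fun_prop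
    obtain ⟨t, ht, hFt⟩ := intermediate_value_Ioo (a := -τ) (b := τ) (by linarith) c.continuousOn
      ⟨hends.1, hends.2⟩
    exact ⟨t, fun _ => ⟨abs_lt.2 ht, hFt⟩⟩
  choose T hT using hex
  have hTlt : ∀ s ∈ Icc (-s₀) s₀, ∀ t : ℝ, |t| ≤ τ → (F (t + s * Complex.I) < 1 ↔ t < T s) ∧
      (1 < F (t + s * Complex.I) ↔ T s < t) := by
    intro s hsI t ht
    obtain ⟨hT1, hT2⟩ := hT s hsI
    rcases lt_trichotomy t (T s) with h | h | h
    · have := hm s (hs s hsI) t (T s) ht hT1.le h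
      rw [hT2] at this
      exact ⟨⟨fun _ => h, fun _ => this⟩, ⟨fun h' => by linarith, fun h' => by linarith⟩⟩
    · rw [h, hT2]
      simp
    · have := hm s (hs s hsI) (T s) t hT1.le ht h
      rw [hT2] at this
      exact ⟨⟨fun h' => by linarith, fun h' => by linarith⟩, ⟨fun _ => h, fun _ => this⟩⟩
  refine ⟨s₀, T, hs₀0, hs₀τ, ?_, ?_, fun s hsI => ⟨(hT s hsI).1, hTlt s hsI⟩⟩
  · intro s hsI
    rw [ContinuousWithinAt, tendsto_order]
    obtain ⟨hT1, hT2⟩ := hT s hsI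
    rw [abs_lt] at hT1
    constructor
    · intro c hc
      set c' := max c (-τ) with hc'
      have h1 : c' < T s := max_lt hc hT1.1
      have h2 : |c'| ≤ τ := abs_le.2 ⟨le_max_right _ _, by linarith⟩
      have h3 := ((hTlt s hsI c' h2).1).2 h1
      have c1 : Continuous fun s : ℝ => F (c' + s * Complex.I) := by fun_prop
      have h4 := c1.continuousAt.eventually_lt continuousAt_const h3
      filter_upwards [mem_nhdsWithin_of_mem_nhds h4, self_mem_nhdsWithin] with s' hs' hs'I
      exact (le_max_left c (-τ)).trans_lt (((hTlt s' hs'I c' h2).1).1 hs')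
    · intro c hc
      set c' := min c τ with hc'
      have h1 : T s < c' := lt_min hc hT1.2
      have h2 : |c'| ≤ τ := abs_le.2 ⟨by linarith, min_le_right _ _⟩
      have h3 := ((hTlt s hsI c' h2).2).2 h1
      have c1 : Continuous fun s : ℝ => F (c' + s * Complex.I) := by fun_prop
      have h4 := continuousAt_const.eventually_lt c1.continuousAt h3
      filter_upwards [mem_nhdsWithin_of_mem_nhds h4, self_mem_nhdsWithin] with s' hs' hs'I
      exact (((hTlt s' hs'I c' h2).2).1 hs').trans_le (min_le_left c τ)
  · have h0I : (0 : ℝ) ∈ Icc (-s₀) s₀ := ⟨by linarith, hs₀0.le⟩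
    have := hTlt 0 h0I 0 (by simpa using hτ0.le)
    rw [hat0] at this
    simp only [lt_self_iff_false, false_iff, not_lt] at this
    exact le_antisymm this.1 this.2

/-- Part of a graph over the imaginary axis is an arc. -/
lemma arcJoined_graph {T : ℝ → ℝ} {s₀ s : ℝ} (hT : ContinuousOn T (Icc (-s₀) s₀)) (hT0 : T 0 = 0)
    (hs : s ∈ Icc (-s₀) s₀) {S : Set ℂ}
    (hS : ∀ s' ∈ uIcc 0 s, ((T s' : ℂ) + s' * Complex.I) ∈ S) :
    ArcJoined S 0 ((T s : ℂ) + s * Complex.I) := by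
  have hs₀ : 0 ≤ s₀ := by linarith [hs.1, hs.2]
  have hsub : uIcc 0 s ⊆ Icc (-s₀) s₀ :=
    uIcc_subset_Icc ⟨by linarith, hs₀⟩ hs
  have hc : ContinuousOn (fun s' : ℝ => (T s' : ℂ) + s' * Complex.I) (uIcc 0 s) :=
    (Complex.continuous_ofReal.comp_continuousOn (hT.mono hsub)).add (by fun_prop)
  have hi : InjOn (fun s' : ℝ => (T s' : ℂ) + s' * Complex.I) (uIcc 0 s) := by
    intro a _ b _ hab
    simpa using congrArg Complex.im hab
  rcases le_total 0 s with h | h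
  · rw [uIcc_of_le h] at *
    exact ⟨0, s, _, h, hc, hi, hS, by simp [hT0], rfl⟩
  · rw [uIcc_of_ge h] at *
    exact ArcJoined.symm ⟨s, 0, _, h, hc, hi, hS, rfl, by simp [hT0]⟩

lemma norm_add_mul_I_lt {t s δ : ℝ} (ht : |t| < δ / 2) (hs : |s| ≤ δ / 2) :
    ‖(t + s * Complex.I : ℂ)‖ < δ := by
  refine (norm_add_le _ _).trans_lt ?_
  simp only [norm_mul, Complex.norm_real, Real.norm_eq_abs, Complex.norm_I, mul_one]
  linarith

/-- The level set of the distance function near a regular point. -/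
lemma locallyArcConnectedAt_of_re_neg {A : Set ℂ} (hA : IsCompact A) (h1 : ∀ n ∈ A, 1 ≤ ‖n‖)
    (hre : ∀ n ∈ A, ‖n‖ = 1 → n.re < 0) {n₀ : ℂ} (hn₀ : n₀ ∈ A) (hn₀1 : ‖n₀‖ = 1) :
    LocallyArcConnectedAt {z | Metric.infDist z A = 1} 0 ∧
      ∀ δ > 0, ∃ z : ℂ, ‖z‖ < δ ∧ 1 < Metric.infDist z A := by
  obtain ⟨ρ, hρ, hmono⟩ := exists_infDist_strictMono hA h1 hre hn₀ hn₀1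
  have h0 : Metric.infDist 0 A = 1 :=
    infDist_eq_one (by simpa using h1) hn₀ (by simpa using hn₀1)
  constructor
  · intro δ hδ
    set τ := min (δ / 2) (ρ / 3) with hτdef
    have hτ : 0 < τ := lt_min (by linarith) (by linarith)
    have hτδ : τ ≤ δ / 2 := min_le_left _ _
    obtain ⟨s₀, T, hs₀, hs₀τ, hTc, hT0, hT⟩ :=
      exists_graph (F := fun z => Metric.infDist z A) (Metric.continuous_infDist_pt A) h0 hmono
        hτ (min_le_right _ _)
    have hs₀δ := hs₀τ.trans hτδ
    refine ⟨min τ s₀, lt_min hτ hs₀, fun y hy hyd => ?_⟩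
    rw [dist_zero_right] at hyd
    have hyI : y.im ∈ Icc (-s₀) s₀ :=
      abs_le.1 ((Complex.abs_im_le_norm y).trans (hyd.le.trans (min_le_right _ _)))
    have hyR : |y.re| ≤ τ := (Complex.abs_re_le_norm y).trans (hyd.le.trans (min_le_left _ _))
    have hyT : y = (T y.im : ℂ) + y.im * Complex.I := by
      have h2 := (hT y.im hyI).2 y.re hyR
      rw [Complex.re_add_im, show Metric.infDist y A = 1 from hy] at h2
      simp only [lt_self_iff_false, false_iff, not_lt] at h2
      rw [← le_antisymm h2.2 h2.1, Complex.re_add_im]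
    rw [hyT]
    refine arcJoined_graph hTc hT0 hyI fun s hs => ?_
    have hsI : s ∈ Icc (-s₀) s₀ := uIcc_subset_Icc ⟨by linarith, hs₀.le⟩ hyI hs
    obtain ⟨h3, h4⟩ := hT s hsI
    have h5 := h4 (T s) h3.le
    simp only [lt_self_iff_false, iff_false, not_lt] at h5
    exact ⟨le_antisymm h5.2 h5.1, by
      rw [mem_ball_zero_iff]
      exact norm_add_mul_I_lt (h3.trans_le hτδ) ((abs_le.2 hsI).trans hs₀δ)⟩
  · intro δ hδ
    set t := min (δ / 2) (ρ / 2) with ht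
    have ht0 : 0 < t := lt_min (by linarith) (by linarith)
    have h2 : ‖((0 : ℂ) + (t : ℂ))‖ = t := by
      rw [zero_add, Complex.norm_real, Real.norm_eq_abs, abs_of_pos ht0]
    refine ⟨0 + t, ?_, ?_⟩
    · rw [h2]; exact (min_le_left _ _).trans_lt (by linarith)
    · have h3 := hmono 0 t (by simpa using hρ) ht0 (by
        rw [h2]; exact (min_le_right _ _).trans_lt (by linarith))
      rwa [h0] at h3

/-- Outside the unit discs about `1`, `-1` and `-i` there remains a cusp at the origin. -/
lemma abs_re_le_sq_of_dist {z : ℂ} (hz : ‖z‖ ≤ 1 / 2) (hp : 1 ≤ dist z 1) (hm : 1 ≤ dist z (-1)) :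
    |z.re| ≤ z.im ^ 2 := by
  have h1 := dist_sq_eq z 1
  have h2 := dist_sq_eq z (-1)
  simp only [Complex.one_re, Complex.one_im, Complex.neg_re, Complex.neg_im] at h1 h2
  have h3 := abs_le.1 ((Complex.abs_re_le_norm z).trans hz)
  rw [abs_le]
  constructor <;> nlinarith

lemma im_nonneg_of_dist {z : ℂ} (hz : ‖z‖ ≤ 1 / 2) (hre : |z.re| ≤ z.im ^ 2)
    (hi : 1 ≤ dist z (-Complex.I)) : 0 ≤ z.im := by
  have h1 := dist_sq_eq z (-Complex.I)
  simp only [Complex.neg_re, Complex.neg_im, Complex.I_re, Complex.I_im] at h1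
  have h3 := abs_le.1 ((Complex.abs_im_le_norm z).trans hz)
  by_contra! hneg
  have h4 : z.re ^ 2 ≤ (z.im ^ 2) ^ 2 := by
    rw [← sq_abs]; gcongr
  have h5 : z.im ^ 2 ≤ 1 / 4 := by nlinarith
  nlinarith [sq_nonneg z.im]

lemma one_lt_dist_of_cusp {z n : ℂ} {κ : ℝ} (hz0 : 0 < z.im) (hre : |z.re| ≤ z.im ^ 2)
    (hzκ : ‖z‖ < κ) (hn : 1 ≤ ‖n‖) (hnre : |n.re| ≤ 1 / 2) (hκ : 0 ≤ n.im → κ ≤ ‖n‖ - 1) :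
    1 < dist z n := by
  rcases le_or_gt 0 n.im with h | h
  · have h1 := norm_sub_norm_le n z
    have h2 := hκ h
    rw [dist_comm, dist_eq_norm]
    linarith
  · have h1 := dist_sq_eq z n
    have h2 : 1 ≤ n.re ^ 2 + n.im ^ 2 := by
      have := dist_sq_eq n 0
      rw [dist_zero_right] at this
      simp only [Complex.zero_re, Complex.zero_im, sub_zero] at this
      nlinarith
    have h3 : n.re ^ 2 ≤ 1 / 4 := by
      rw [← sq_abs]; nlinarith [abs_nonneg n.re]
    have h4 : n.im ≤ -(1 / 2) := by nlinarith
    have h5 : z.re * n.re ≤ |z.re| * (1 / 2) := by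
      refine (le_abs_self _).trans ?_
      rw [abs_mul]; gcongr
    have h6 : 1 < dist z n ^ 2 := by
      rw [h1]; nlinarith [sq_nonneg z.re]
    exact (one_lt_sq_iff₀ dist_nonneg).1 h6

/-- The level set of the distance function near a critical point: two graphs over the positive
imaginary axis, which bound a cusp. The hypothesis `hopen` says that the cusp is not closed off
near its tip. -/
lemma exists_cusp_graphs {A : Set ℂ} (hA : IsCompact A) (h1 : ∀ n ∈ A, 1 ≤ ‖n‖)
    (him : ∀ n ∈ A, ‖n‖ = 1 → n.im ≤ 0) (hp : (1 : ℂ) ∈ A) (hm : (-1 : ℂ) ∈ A)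
    (hi : -Complex.I ∈ A) {r₁ : ℝ} (hr₁ : 0 < r₁)
    (hopen : ∀ r s : ℝ, 0 < s → s ≤ r → r < r₁ →
      ∃ u : ℝ, |u| ≤ r ∧ 1 ≤ Metric.infDist (u + s * Complex.I) A) {δ : ℝ} (hδ : 0 < δ) :
    ∃ (s₀ : ℝ) (L R : ℝ → ℝ), 0 < s₀ ∧ s₀ ≤ δ ∧ ContinuousOn L (Icc (-s₀) s₀) ∧
      ContinuousOn R (Icc (-s₀) s₀) ∧ L 0 = 0 ∧ R 0 = 0 ∧
      (∀ s ∈ Icc 0 s₀, |L s| < δ ∧ |R s| < δ ∧ Metric.infDist (L s + s * Complex.I) A = 1 ∧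
        Metric.infDist (R s + s * Complex.I) A = 1) ∧
      ∀ y : ℂ, Metric.infDist y A = 1 → ‖y‖ < s₀ → 0 ≤ y.im ∧ (y.re = L y.im ∨ y.re = R y.im) := by
  have hne : A.Nonempty := ⟨_, hp⟩
  set AL := A ∩ {n | n.re ≤ -(1 / 2)} with hAL
  set AR := A ∩ {n | 1 / 2 ≤ n.re} with hAR
  have hALc : IsCompact AL :=
    hA.inter_right (isClosed_le Complex.continuous_re continuous_const)
  have hARc : IsCompact AR :=
    hA.inter_right (isClosed_le continuous_const Complex.continuous_re)
  have hmL : (-1 : ℂ) ∈ AL := ⟨hm, by simp; norm_num⟩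
  have hpR : (1 : ℂ) ∈ AR := ⟨hp, by simp; norm_num⟩
  obtain ⟨ρL, hρL, hmonoL⟩ := exists_infDist_strictMono hALc (fun n hn => h1 n hn.1)
    (fun n hn _ => lt_of_le_of_lt hn.2 (by norm_num)) hmL (by simp)
  -- The right part is treated by reflection in the imaginary axis.
  set ψ : ℂ → ℂ := fun z => -(starRingEnd ℂ) z with hψ
  have hψi : Isometry ψ := by
    refine Isometry.of_dist_eq fun z w => ?_
    simp only [hψ, dist_neg_neg, Complex.dist_conj_conj]
  set B := ψ '' AR with hB
  have hBc : IsCompact B := hARc.image hψi.continuous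
  have hBd : ∀ t s : ℝ, Metric.infDist ((t : ℂ) + s * Complex.I) B =
      Metric.infDist (((-t : ℝ) : ℂ) + s * Complex.I) AR := by
    intro t s
    have h2 : (t : ℂ) + s * Complex.I = ψ (((-t : ℝ) : ℂ) + s * Complex.I) := by
      simp [hψ]; ring
    rw [h2, hB, Metric.infDist_image hψi]
  have hnψ : ∀ n, ‖ψ n‖ = ‖n‖ := fun n => by simp [hψ]
  obtain ⟨ρR, hρR, hmonoR⟩ := exists_infDist_strictMono hBc (n₀ := ψ 1)
    (by rintro _ ⟨n, hn, rfl⟩; rw [hnψ]; exact h1 n hn.1)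
    (by
      rintro _ ⟨n, hn, rfl⟩ -
      have : (1 : ℝ) / 2 ≤ n.re := hn.2
      simp only [hψ, Complex.neg_re, Complex.conj_re]
      linarith) (mem_image_of_mem _ hpR) (by simp [hψ])
  have hA0c : IsCompact (A ∩ {n | |n.re| ≤ 1 / 2} ∩ {n | 0 ≤ n.im}) :=
    (hA.inter_right (isClosed_le (by fun_prop) continuous_const)).inter_right
      (isClosed_le continuous_const Complex.continuous_im)
  obtain ⟨κ, hκ, hκA⟩ := exists_pos_le_of_isCompact hA0c (f := fun n => ‖n‖ - 1) (by fun_prop) (by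
    rintro n ⟨⟨hn, hnre⟩, hnim⟩
    rcases (h1 n hn).lt_or_eq with h | h
    · linarith
    · exfalso
      have h2 : n.im = 0 := le_antisymm (him n hn h.symm) hnim
      have h3 := Complex.abs_re_eq_norm.2 h2
      have h4 : |n.re| ≤ 1 / 2 := hnre
      linarith)
  set τ := min (min (min δ (1 / 4)) (min (r₁ / 2) (κ / 4))) (min (ρL / 3) (ρR / 3)) with hτdef
  have hτ : 0 < τ := by
    refine lt_min (lt_min (lt_min hδ (by norm_num)) (lt_min ?_ ?_)) (lt_min ?_ ?_) <;> linarith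
  have hτδ : τ ≤ δ := (min_le_left _ _).trans ((min_le_left _ _).trans (min_le_left _ _))
  have hτ4 : τ ≤ 1 / 4 := (min_le_left _ _).trans ((min_le_left _ _).trans (min_le_right _ _))
  have hτr : τ ≤ r₁ / 2 := (min_le_left _ _).trans ((min_le_right _ _).trans (min_le_left _ _))
  have hτκ : τ ≤ κ / 4 := (min_le_left _ _).trans ((min_le_right _ _).trans (min_le_right _ _))
  have hτL : τ ≤ ρL / 3 := (min_le_right _ _).trans (min_le_left _ _)
  have hτR : τ ≤ ρR / 3 := (min_le_right _ _).trans (min_le_right _ _)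
  have hL1 : Metric.infDist 0 AL = 1 :=
    infDist_eq_one (by simpa using fun n hn => h1 n hn.1) hmL (by simp)
  have hB1 : Metric.infDist 0 B = 1 := by
    refine infDist_eq_one ?_ (mem_image_of_mem ψ hpR) (by rw [dist_zero_left, hnψ, norm_one])
    rintro _ ⟨n, hn, rfl⟩
    rw [dist_zero_left, hnψ]
    exact h1 n hn.1
  obtain ⟨sL, L, hsL, hsLτ, hLc, hL0, hL⟩ := exists_graph
    (F := fun z => Metric.infDist z AL) (Metric.continuous_infDist_pt AL) hL1 hmonoL hτ hτL
  obtain ⟨sR, R', hsR, hsRτ, hRc, hR0, hR'⟩ := exists_graph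
    (F := fun z => Metric.infDist z B) (Metric.continuous_infDist_pt B) hB1 hmonoR hτ hτR
  set R : ℝ → ℝ := fun s => -R' s with hRdef
  have hR : ∀ s ∈ Icc (-sR) sR, |R s| < τ ∧ ∀ t : ℝ, |t| ≤ τ →
      (Metric.infDist ((t : ℂ) + s * Complex.I) AR < 1 ↔ R s < t) ∧
        (1 < Metric.infDist ((t : ℂ) + s * Complex.I) AR ↔ t < R s) := by
    intro s hs
    obtain ⟨h2, h3⟩ := hR' s hs
    refine ⟨by simpa [hRdef] using h2, fun t ht => ?_⟩
    have h4 := h3 (-t) (by rwa [abs_neg])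
    rw [hBd, neg_neg] at h4
    simp only [hRdef]
    rw [h4.1, h4.2]
    exact ⟨neg_lt, lt_neg⟩
  set s₀ := min sL sR with hs₀def
  have hs₀ : 0 < s₀ := lt_min hsL hsR
  have hs₀L : s₀ ≤ sL := min_le_left _ _
  have hs₀R : s₀ ≤ sR := min_le_right _ _
  have hs₀τ : s₀ ≤ τ := hs₀L.trans hsLτ
  have hmemL : ∀ s ∈ Icc 0 s₀, s ∈ Icc (-sL) sL := fun s hs =>
    ⟨by linarith [hs.1], hs.2.trans hs₀L⟩
  have hmemR : ∀ s ∈ Icc 0 s₀, s ∈ Icc (-sR) sR := fun s hs =>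
    ⟨by linarith [hs.1], hs.2.trans hs₀R⟩
  -- The two graphs do not cross.
  have hLR : ∀ s ∈ Icc 0 s₀, L s ≤ R s := by
    intro s hs
    rcases hs.1.eq_or_lt with rfl | hpos
    · rw [hL0]; simp [hRdef, hR0]
    · obtain ⟨u, hu, hu1⟩ := hopen τ s hpos (hs.2.trans hs₀τ) (by linarith)
      have h2 := hu1.trans (Metric.infDist_le_infDist_of_subset inter_subset_left ⟨_, hmL⟩)
      have h3 := hu1.trans (Metric.infDist_le_infDist_of_subset inter_subset_left ⟨_, hpR⟩)
      have h4 := mt (((hL s (hmemL s hs)).2 u hu).1).2 (not_lt.2 h2)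
      have h5 := mt (((hR s (hmemR s hs)).2 u hu).1).2 (not_lt.2 h3)
      linarith
  have hsplit : ∀ n ∈ A, n ∈ AL ∨ n ∈ AR ∨ |n.re| ≤ 1 / 2 := by
    intro n hn
    by_cases h2 : n.re ≤ -(1 / 2)
    · exact Or.inl ⟨hn, h2⟩
    by_cases h3 : 1 / 2 ≤ n.re
    · exact Or.inr (Or.inl ⟨hn, h3⟩)
    · exact Or.inr (Or.inr (abs_le.2 ⟨by linarith, by linarith⟩))
  have hfar : ∀ z : ℂ, 0 < z.im → |z.re| ≤ z.im ^ 2 → ‖z‖ < κ → ∀ n ∈ A, |n.re| ≤ 1 / 2 →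
      1 < dist z n := fun z hz0 hre hzκ n hn hnre =>
    one_lt_dist_of_cusp hz0 hre hzκ (h1 n hn) hnre fun h => hκA n ⟨⟨hn, hnre⟩, h⟩
  have hnorm : ∀ t s : ℝ, |t| < τ → |s| ≤ τ → ‖(t + s * Complex.I : ℂ)‖ < 2 * τ := by
    intro t s ht hs
    exact norm_add_mul_I_lt (by linarith) (by linarith)
  have hall : ∀ t s : ℝ, |t| < τ → s ∈ Icc 0 s₀ →
      1 ≤ Metric.infDist ((t : ℂ) + s * Complex.I) AL →
      1 ≤ Metric.infDist ((t : ℂ) + s * Complex.I) AR → t = 0 ∨ s ≠ 0 →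
      ∀ n ∈ A, 1 ≤ dist ((t : ℂ) + s * Complex.I) n := by
    intro t s ht hs hdL hdR hts n hn
    have hsτ : |s| ≤ τ := by rw [abs_of_nonneg hs.1]; exact hs.2.trans hs₀τ
    have hnz := hnorm t s ht hsτ
    rcases hsplit n hn with h | h | h
    · exact hdL.trans (Metric.infDist_le_dist_of_mem h)
    · exact hdR.trans (Metric.infDist_le_dist_of_mem h)
    · rcases hs.1.eq_or_lt with rfl | hpos
      · have : t = 0 := hts.resolve_right (by simp)
        simpa [this] using h1 n hn
      · refine (hfar _ (by simpa using hpos) ?_ (by linarith) n hn h).le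
        exact abs_re_le_sq_of_dist (by linarith)
          (hdR.trans (Metric.infDist_le_dist_of_mem hpR))
          (hdL.trans (Metric.infDist_le_dist_of_mem hmL))
  have hsub : Icc (-s₀) s₀ ⊆ Icc (-sL) sL := Icc_subset_Icc (by linarith) hs₀L
  have hsub' : Icc (-s₀) s₀ ⊆ Icc (-sR) sR := Icc_subset_Icc (by linarith) hs₀R
  refine ⟨s₀, L, R, hs₀, hs₀τ.trans hτδ, hLc.mono hsub, (hRc.mono hsub').neg, hL0,
    by simp [hRdef, hR0], ?_, ?_⟩
  · intro s hs
    obtain ⟨hLτ, hLs⟩ := hL s (hmemL s hs)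
    obtain ⟨hRτ, hRs⟩ := hR s (hmemR s hs)
    have hle := hLR s hs
    have h2 := hLs (L s) hLτ.le
    have h3 := hLs (R s) hRτ.le
    have h4 := hRs (L s) hLτ.le
    have h5 := hRs (R s) hRτ.le
    have hzero : s = 0 → L s = 0 ∧ R s = 0 := by
      rintro rfl
      exact ⟨hL0, by simp [hRdef, hR0]⟩
    refine ⟨hLτ.trans_le hτδ, hRτ.trans_le hτδ, ?_, ?_⟩
    · have e1 : Metric.infDist ((L s : ℂ) + s * Complex.I) AL = 1 :=
        le_antisymm (not_lt.1 (mt h2.2.1 (lt_irrefl _))) (not_lt.1 (mt h2.1.1 (lt_irrefl _)))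
      obtain ⟨n, hn, hnd⟩ := hALc.exists_infDist_eq_dist ⟨_, hmL⟩ ((L s : ℂ) + s * Complex.I)
      refine infDist_eq_one (hall _ _ hLτ hs e1.ge (not_lt.1 (mt h4.1.1 (not_lt.2 hle))) ?_)
        hn.1 (by rw [← hnd, e1])
      by_cases h : s = 0
      · exact Or.inl (hzero h).1
      · exact Or.inr h
    · have e1 : Metric.infDist ((R s : ℂ) + s * Complex.I) AR = 1 :=
        le_antisymm (not_lt.1 (mt h5.2.1 (lt_irrefl _))) (not_lt.1 (mt h5.1.1 (lt_irrefl _)))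
      obtain ⟨n, hn, hnd⟩ := hARc.exists_infDist_eq_dist ⟨_, hpR⟩ ((R s : ℂ) + s * Complex.I)
      refine infDist_eq_one (hall _ _ hRτ hs (not_lt.1 (mt h3.1.1 (not_lt.2 hle))) e1.ge ?_)
        hn.1 (by rw [← hnd, e1])
      by_cases h : s = 0
      · exact Or.inl (hzero h).2
      · exact Or.inr h
  · intro y hy hys
    have hyd : ∀ n ∈ A, 1 ≤ dist y n := fun n hn => hy ▸ Metric.infDist_le_dist_of_mem hn
    have hyn : ‖y‖ ≤ 1 / 2 := by linarith
    have hre := abs_re_le_sq_of_dist hyn (hyd _ hp) (hyd _ hm)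
    have h0 := im_nonneg_of_dist hyn hre (hyd _ hi)
    refine ⟨h0, ?_⟩
    have hyI : y.im ∈ Icc 0 s₀ :=
      ⟨h0, (le_abs_self _).trans ((Complex.abs_im_le_norm y).trans hys.le)⟩
    have hyR : |y.re| ≤ τ := (Complex.abs_re_le_norm y).trans (hys.le.trans hs₀τ)
    obtain ⟨n, hn, hnd⟩ := hA.exists_infDist_eq_dist hne y
    rw [hy] at hnd
    rcases hsplit n hn with h | h | h
    · left
      have h2 := (hL _ (hmemL _ hyI)).2 y.re hyR
      rw [Complex.re_add_im] at h2
      have e1 := infDist_eq_one (fun n hn => hyd n hn.1) h hnd.symm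
      rw [e1] at h2
      exact le_antisymm (not_lt.1 (mt h2.2.2 (lt_irrefl _))) (not_lt.1 (mt h2.1.2 (lt_irrefl _)))
    · right
      have h2 := (hR _ (hmemR _ hyI)).2 y.re hyR
      rw [Complex.re_add_im] at h2
      have e1 := infDist_eq_one (fun n hn => hyd n hn.1) h hnd.symm
      rw [e1] at h2
      exact le_antisymm (not_lt.1 (mt h2.1.2 (lt_irrefl _))) (not_lt.1 (mt h2.2.2 (lt_irrefl _)))
    · left
      rcases h0.eq_or_lt with h2 | h2
      · rw [← h2, hL0]
        rw [← h2] at hre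
        simpa using hre
      · have := hfar y h2 hre (by linarith) n hn h
        linarith

/-- The level set of the distance function near a critical point is locally arcwise connected, and
there are points of the level set arbitrarily close to it whose nearest points are seen under
angles of less than `π / 4` with the real axis, so that these points are not critical. -/
lemma locallyArcConnectedAt_of_cusp {A : Set ℂ} (hA : IsCompact A) (h1 : ∀ n ∈ A, 1 ≤ ‖n‖)
    (him : ∀ n ∈ A, ‖n‖ = 1 → n.im ≤ 0) (hp : (1 : ℂ) ∈ A) (hm : (-1 : ℂ) ∈ A)
    (hi : -Complex.I ∈ A) {r₁ : ℝ} (hr₁ : 0 < r₁)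
    (hopen : ∀ r s : ℝ, 0 < s → s ≤ r → r < r₁ →
      ∃ u : ℝ, |u| ≤ r ∧ 1 ≤ Metric.infDist (u + s * Complex.I) A) :
    LocallyArcConnectedAt {z | Metric.infDist z A = 1} 0 ∧
      ∀ δ > 0, ∃ z : ℂ, ‖z‖ < δ ∧ Metric.infDist z A = 1 ∧
        ∀ n ∈ A, dist n z = 1 → |(n - z).im| ≤ 7 / 10 := by
  constructor
  · intro δ hδ
    obtain ⟨s₀, L, R, hs₀, hs₀δ, hLc, hRc, hL0, hR0, hs, hy⟩ :=
      exists_cusp_graphs hA h1 him hp hm hi hr₁ hopen (half_pos hδ)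
    refine ⟨s₀, hs₀, fun y hyA hyd => ?_⟩
    rw [dist_zero_right] at hyd
    obtain ⟨h0, hyT⟩ := hy y hyA hyd
    have hy0 : y.im ≤ s₀ := (le_abs_self _).trans ((Complex.abs_im_le_norm y).trans hyd.le)
    have hyI : y.im ∈ Icc (-s₀) s₀ := ⟨by linarith, hy0⟩
    have hsub : ∀ s ∈ uIcc 0 y.im, s ∈ Icc 0 s₀ := by
      intro s hs
      rw [uIcc_of_le h0] at hs
      exact ⟨hs.1, hs.2.trans hy0⟩
    have habs : ∀ s ∈ Icc 0 s₀, |s| ≤ δ / 2 := fun s hs => by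
      rw [abs_of_nonneg hs.1]; exact hs.2.trans hs₀δ
    rcases hyT with h | h
    · have := arcJoined_graph hLc hL0 hyI
        (S := {z | Metric.infDist z A = 1} ∩ Metric.ball 0 δ) fun s hsI => by
          obtain ⟨e1, -, e3, -⟩ := hs s (hsub s hsI)
          exact ⟨e3, by
            rw [mem_ball_zero_iff]; exact norm_add_mul_I_lt e1 (habs s (hsub s hsI))⟩
      rwa [← h, Complex.re_add_im] at this
    · have := arcJoined_graph hRc hR0 hyI
        (S := {z | Metric.infDist z A = 1} ∩ Metric.ball 0 δ) fun s hsI => by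
          obtain ⟨-, e2, -, e4⟩ := hs s (hsub s hsI)
          exact ⟨e4, by
            rw [mem_ball_zero_iff]; exact norm_add_mul_I_lt e2 (habs s (hsub s hsI))⟩
      rwa [← h, Complex.re_add_im] at this
  · intro δ hδ
    obtain ⟨κ, hκ, hκA⟩ := exists_pos_le_of_isCompact
      (hA.inter_right (isClosed_le continuous_const Complex.continuous_im : IsClosed
        {n : ℂ | (1 : ℝ) / 2 ≤ n.im})) (f := fun n => ‖n‖ - 1) (by fun_prop) (by
      rintro n ⟨hn, hnim⟩
      rcases (h1 n hn).lt_or_eq with h | h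
      · linarith
      · have h2 := him n hn h.symm
        have h3 : (1 : ℝ) / 2 ≤ n.im := hnim
        linarith)
    set δ' := min δ (min κ (1 / 2)) with hδ'
    have hδ'0 : 0 < δ' := lt_min hδ (lt_min hκ (by norm_num))
    have hδ'δ : δ' ≤ δ := min_le_left _ _
    have hδ'κ : δ' ≤ κ := (min_le_right _ _).trans (min_le_left _ _)
    have hδ'2 : δ' ≤ 1 / 2 := (min_le_right _ _).trans (min_le_right _ _)
    obtain ⟨s, L, R, hs0, hsδ, -, -, -, -, hs, -⟩ :=
      exists_cusp_graphs hA h1 him hp hm hi hr₁ hopen (half_pos hδ'0)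
    obtain ⟨e1, -, e3, -⟩ := hs s ⟨hs0.le, le_rfl⟩
    set z : ℂ := (L s : ℂ) + s * Complex.I with hz
    have hzn : ‖z‖ < δ' := norm_add_mul_I_lt e1 (by rw [abs_of_pos hs0]; exact hsδ)
    have hzim : z.im = s := by simp [hz]
    have hzd : ∀ n ∈ A, 1 ≤ dist z n := fun n hn => e3 ▸ Metric.infDist_le_dist_of_mem hn
    have hre := abs_re_le_sq_of_dist (by linarith) (hzd _ hp) (hzd _ hm)
    rw [hzim] at hre
    refine ⟨z, hzn.trans_le hδ'δ, e3, fun n hn hnz => ?_⟩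
    have h2 := dist_sq_eq n z
    have h3 := dist_sq_eq n 0
    rw [dist_zero_right] at h3
    simp only [Complex.zero_re, Complex.zero_im, sub_zero] at h3
    rw [hnz] at h2
    have h4 := h1 n hn
    rw [Complex.sub_im, abs_le]
    constructor
    · set c := n.re - z.re with hc
      set k := n.im - z.im with hk
      have hcn : n.re = c + z.re := by rw [hc]; ring
      have hkn : n.im = k + s := by rw [hk, hzim]; ring
      rw [hcn, hkn] at h3
      have hc1 : |c| ≤ 1 := by
        rw [abs_le]; constructor <;> nlinarith
      have hcz : c * z.re ≤ s ^ 2 := by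
        refine (le_abs_self _).trans ?_
        rw [abs_mul]
        nlinarith [abs_nonneg c, abs_nonneg z.re]
      have hzz : z.re ^ 2 ≤ s ^ 2 := by
        rw [← sq_abs]
        have : |z.re| ≤ s := hre.trans (by nlinarith)
        nlinarith [abs_nonneg z.re]
      have h5 : 0 ≤ k * s + 2 * s ^ 2 := by nlinarith
      have h6 : 0 ≤ k + 2 * s := by
        by_contra! h
        nlinarith
      linarith
    · by_contra! h
      have h5 := hκA n ⟨hn, show (1 : ℝ) / 2 ≤ n.im by rw [hzim] at h; linarith⟩
      have h6 := norm_sub_norm_le n z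
      rw [← dist_eq_norm, hnz] at h6
      linarith

/-! ### Level sets as Jordan curves -/

lemma infDist_affine {Γ : Set ℂ} (hne : Γ.Nonempty) (x : ℂ) {v : ℂ} (hv : v ≠ 0) (z : ℂ) :
    Metric.infDist (x + v * z) Γ = ‖v‖ * Metric.infDist z ((fun z => x + v * z) ⁻¹' Γ) := by
  have hvn : 0 < ‖v‖ := norm_pos_iff.2 hv
  have hd : ∀ z w : ℂ, dist (x + v * z) (x + v * w) = ‖v‖ * dist z w := fun z w => by
    rw [dist_add_left, dist_eq_norm, ← mul_sub, norm_mul, dist_eq_norm]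
  have hsurj : ∀ n : ℂ, ∃ m, n = x + v * m := fun n => ⟨(n - x) / v, by field_simp; ring⟩
  have hne' : ((fun z => x + v * z) ⁻¹' Γ).Nonempty := by
    obtain ⟨n, hn⟩ := hne
    obtain ⟨m, rfl⟩ := hsurj n
    exact ⟨m, hn⟩
  apply le_antisymm
  · rw [← div_le_iff₀' hvn, Metric.le_infDist hne']
    intro m hm
    rw [div_le_iff₀' hvn, ← hd]
    exact Metric.infDist_le_dist_of_mem hm
  · rw [Metric.le_infDist hne]
    intro n hn
    obtain ⟨m, rfl⟩ := hsurj n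
    rw [hd]
    exact mul_le_mul_of_nonneg_left (Metric.infDist_le_dist_of_mem hn) hvn.le

lemma isCompact_preimage_affine {Γ : Set ℂ} (hcpt : IsCompact Γ) (x : ℂ) {v : ℂ} (hv : v ≠ 0) :
    IsCompact ((fun z => x + v * z) ⁻¹' Γ) := by
  have h : (fun z => x + v * z) ⁻¹' Γ = (fun n => (n - x) / v) '' Γ := by
    ext z
    constructor
    · exact fun hz => ⟨_, hz, by field_simp; ring⟩
    · rintro ⟨n, hn, rfl⟩
      rw [mem_preimage, mul_div_cancel₀ _ hv, add_sub_cancel]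
      exact hn
  rw [h]
  exact hcpt.image (by fun_prop)

lemma LocallyArcConnectedAt.affine {Γ D : Set ℂ} (hne : Γ.Nonempty) {x v : ℂ} (hv : v ≠ 0)
    (hD : Metric.ball x ‖v‖ ⊆ D)
    (h : LocallyArcConnectedAt {z | Metric.infDist z ((fun z => x + v * z) ⁻¹' Γ) = 1} 0) :
    LocallyArcConnectedAt {z | z ∈ D ∧ Metric.infDist z Γ = ‖v‖} x := by
  have hvn : 0 < ‖v‖ := norm_pos_iff.2 hv
  intro δ hδ
  obtain ⟨η, hη, harc⟩ := h (min (δ / ‖v‖) 1) (lt_min (by positivity) one_pos)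
  refine ⟨‖v‖ * η, by positivity, fun y hy hyd => ?_⟩
  have hyv : x + v * ((y - x) / v) = y := by field_simp; ring
  have h1 : Metric.infDist ((y - x) / v) ((fun z => x + v * z) ⁻¹' Γ) = 1 := by
    have h2 := infDist_affine hne x hv ((y - x) / v)
    rw [hyv, hy.2] at h2
    exact mul_left_cancel₀ hvn.ne' (by rw [← h2, mul_one])
  have h3 := harc _ h1 (by
    rw [dist_zero_right, norm_div, div_lt_iff₀' hvn, ← dist_eq_norm]; exact hyd)
  have h4 := h3.map (φ := fun z => x + v * z)
    (U := {z | z ∈ D ∧ Metric.infDist z Γ = ‖v‖} ∩ Metric.ball x δ) (by fun_prop) ?_ ?_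
  · simpa [hyv] using h4
  · intro z _ w _ hzw
    exact mul_left_cancel₀ hv (add_left_cancel hzw)
  · rintro z ⟨hz1, hz2⟩
    rw [mem_ball_zero_iff] at hz2
    have h5 : dist (x + v * z) x = ‖v‖ * ‖z‖ := by
      rw [dist_eq_norm, add_sub_cancel_left, norm_mul]
    refine ⟨⟨hD ?_, ?_⟩, ?_⟩
    · rw [Metric.mem_ball, h5]
      have := hz2.trans_le (min_le_right _ _)
      nlinarith
    · rw [infDist_affine hne x hv, show Metric.infDist z _ = 1 from hz1, mul_one]
    · rw [Metric.mem_ball, h5, ← lt_div_iff₀' hvn]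
      exact hz2.trans_le (min_le_left _ _)

lemma isCompact_infDist_le {Γ : Set ℂ} (hcpt : IsCompact Γ) (hne : Γ.Nonempty) (e : ℝ) :
    IsCompact {z | Metric.infDist z Γ ≤ e} := by
  refine Metric.isCompact_of_isClosed_isBounded
    (isClosed_le (Metric.continuous_infDist_pt Γ) continuous_const) ?_
  obtain ⟨R, hR⟩ := hcpt.isBounded.subset_closedBall 0
  refine (Metric.isBounded_closedBall (x := (0 : ℂ)) (r := e + R)).subset fun z hz => ?_
  obtain ⟨p, hp, hpz⟩ := hcpt.exists_infDist_eq_dist hne z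
  have h1 : dist z p ≤ e := hpz ▸ hz
  have h2 : dist p 0 ≤ R := hR hp
  exact (dist_triangle z p 0).trans (by linarith)

lemma ball_infDist_subset_connectedComponentIn {Γ : Set ℂ} {x z : ℂ}
    (hx : x ∈ connectedComponentIn Γᶜ z) :
    Metric.ball x (Metric.infDist x Γ) ⊆ connectedComponentIn Γᶜ z := by
  rcases (Metric.infDist_nonneg (x := x) (s := Γ)).eq_or_lt with h | h
  · rw [← h, Metric.ball_zero]; exact empty_subset _
  · rw [connectedComponentIn_eq hx]
    exact (convex_ball x _).isPreconnected.subset_connectedComponentIn (Metric.mem_ball_self h)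
      Metric.ball_infDist_subset_compl

/-- Points at distance more than `e` from `Γ` in one component of the complement of `Γ` can be
joined at distance more than `e` from `Γ`. -/
lemma isPreconnected_infDist_gt {Γ : Set ℂ} (hcpt : IsCompact Γ) (hne : Γ.Nonempty) {r₀ e : ℝ}
    (hΓ : ChordCondition Γ r₀) (he0 : 0 < e) (he : 2 * e < r₀) (b : ℂ) :
    IsPreconnected {z | z ∈ connectedComponentIn Γᶜ b ∧ e < Metric.infDist z Γ} := by
  refine isPreconnected_of_forall_pair fun a ha c hc => ?_
  set K := {z | Metric.infDist z Γ ≤ e} with hK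
  have hKc : IsCompact K := isCompact_infDist_le hcpt hne e
  have haK : a ∉ K := not_le.2 ha.2
  have hcK : c ∉ K := not_le.2 hc.2
  set e' := min (min (Metric.infDist a Γ) (Metric.infDist c Γ)) (r₀ / 2) with he'
  have hee' : e < e' := lt_min (lt_min ha.2 hc.2) (by linarith)
  have hle : ∀ {z}, e' ≤ Metric.infDist z Γ → ∀ w ∈ Γ, e' ≤ dist w z := fun hz w hw => by
    rw [dist_comm]; exact hz.trans (Metric.infDist_le_dist_of_mem hw)
  have her : e' ≤ r₀ / 2 := min_le_right _ _
  have hlog := hasLogOn_infDist_lt hne hΓ (e := e') (by linarith)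
    (hle ((min_le_left _ _).trans (min_le_left _ _)))
    (hle ((min_le_left _ _).trans (min_le_right _ _)))
    (hasLogOn_of_isPreconnected hcpt.isClosed isPreconnected_connectedComponentIn
      (connectedComponentIn_subset _ b) ha.1 hc.1)
  have heq := connectedComponentIn_eq_of_hasLogOn hKc haK hcK
    (hlog.mono fun z (hz : Metric.infDist z Γ ≤ e) => hz.trans_lt hee')
  refine ⟨connectedComponentIn Kᶜ a, fun z hz => ⟨?_, ?_⟩, mem_connectedComponentIn haK,
    heq ▸ mem_connectedComponentIn hcK, isPreconnected_connectedComponentIn⟩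
  · rw [connectedComponentIn_eq ha.1]
    refine isPreconnected_connectedComponentIn.subset_connectedComponentIn
      (mem_connectedComponentIn haK) ((connectedComponentIn_subset _ _).trans ?_) hz
    refine compl_subset_compl.2 fun w hw => ?_
    rw [hK, mem_ofPred_eq, Metric.infDist_zero_of_mem hw]
    exact he0.le
  · exact not_le.1 (connectedComponentIn_subset _ _ hz)

/-- The points that are close to `Γ` or outside the given component of its complement form an open
connected set: the segment from such a point to a nearest point of `Γ` stays inside. -/
lemma isOpen_and_isPreconnected_infDist_lt {Γ : Set ℂ} (hcpt : IsCompact Γ) (hconn : IsConnected Γ)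
    {e : ℝ} (he0 : 0 < e) (b : ℂ) :
    IsOpen {z | z ∈ connectedComponentIn Γᶜ b → Metric.infDist z Γ < e} ∧
      IsPreconnected {z | z ∈ connectedComponentIn Γᶜ b → Metric.infDist z Γ < e} := by
  constructor
  · rw [isOpen_iff_mem_nhds]
    intro z hz
    by_cases hlt : Metric.infDist z Γ < e
    · filter_upwards [(Metric.continuous_infDist_pt Γ).continuousAt.eventually_lt
        continuousAt_const hlt] with w hw _ using hw
    · have hzD : z ∉ connectedComponentIn Γᶜ b := fun h => hlt (hz h)
      have hzΓ : z ∈ Γᶜ := fun h => hlt (by rw [Metric.infDist_zero_of_mem h]; exact he0)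
      have ho : IsOpen (connectedComponentIn Γᶜ z) :=
        hcpt.isClosed.isOpen_compl.connectedComponentIn
      filter_upwards [ho.mem_nhds (mem_connectedComponentIn hzΓ)] with w hw hwD
      refine absurd ?_ hzD
      rw [connectedComponentIn_eq hwD, ← connectedComponentIn_eq hw]
      exact mem_connectedComponentIn hzΓ
  · obtain ⟨p₀, hp₀⟩ := hconn.nonempty
    have hΓV : Γ ⊆ {z | z ∈ connectedComponentIn Γᶜ b → Metric.infDist z Γ < e} := fun p hp _ => by
      rw [Metric.infDist_zero_of_mem hp]; exact he0
    refine isPreconnected_of_forall p₀ fun z hz => ?_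
    obtain ⟨p, hp, hpz⟩ := hcpt.exists_infDist_eq_dist ⟨_, hp₀⟩ z
    refine ⟨segment ℝ z p ∪ Γ, union_subset ?_ hΓV, Or.inr hp₀, Or.inl (left_mem_segment ℝ z p),
      (convex_segment z p).isPreconnected.union p (right_mem_segment ℝ z p) hp
        hconn.isPreconnected⟩
    intro w hw hwD
    have hadd := dist_add_dist_of_mem_segment hw
    have hwp : Metric.infDist w Γ ≤ dist w p := Metric.infDist_le_dist_of_mem hp
    by_cases hlt : Metric.infDist z Γ < e
    · have := dist_nonneg (x := z) (y := w)
      linarith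
    · have hwΓ : w ∉ Γ := connectedComponentIn_subset _ _ hwD
      have hwp0 : 0 < dist w p := dist_pos.2 fun h => hwΓ (h ▸ hp)
      have hzΓ : z ∈ Γᶜ := fun h => hlt (by rw [Metric.infDist_zero_of_mem h]; exact he0)
      have hwz : w ∈ connectedComponentIn Γᶜ z :=
        ball_infDist_subset_connectedComponentIn (mem_connectedComponentIn hzΓ)
          (by rw [Metric.mem_ball, dist_comm]; linarith)
      refine absurd (hz ?_) hlt
      rw [connectedComponentIn_eq hwD, ← connectedComponentIn_eq hwz]
      exact mem_connectedComponentIn hzΓ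

/-- A compact set without interior whose complement consists of two connected open sets that
accumulate at each of its points is a Jordan curve as soon as it contains one. -/
lemma IsJordan.eq_of_subset {C X U V : Set ℂ} (hC : IsJordan C) (hCX : C ⊆ X)
    (hU : IsPreconnected U) (hV : IsPreconnected V) (hXU : X ⊆ closure U) (hXV : X ⊆ closure V)
    (hcompl : Xᶜ = U ∪ V) : C = X := by
  by_contra hne
  obtain ⟨x, hx, hxC⟩ : ∃ x ∈ X, x ∉ C := by
    by_contra! h
    exact hne (hCX.antisymm h)
  refine hC.not_isPreconnected_compl ?_
  have hU' : IsPreconnected (U ∪ X \ C) :=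
    hU.subset_closure subset_union_left
      (union_subset subset_closure (sdiff_subset.trans hXU))
  have hV' : IsPreconnected (V ∪ X \ C) :=
    hV.subset_closure subset_union_left
      (union_subset subset_closure (sdiff_subset.trans hXV))
  have h := hU'.union x (Or.inr ⟨hx, hxC⟩) (Or.inr ⟨hx, hxC⟩) hV'
  convert h using 1
  ext z
  have h1 : z ∈ Xᶜ ↔ z ∈ U ∪ V := by rw [hcompl]
  have h2 := @hCX z
  simp only [mem_union, mem_compl_iff, mem_sdiff] at h1 ⊢
  tauto

/-- The part of the level set of the distance function in a component of the complement of `Γ` is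
a Jordan curve, provided that the level is not the maximum. -/
theorem isJordan_infDist_eq {Γ : Set ℂ} (hcpt : IsCompact Γ) (hconn : IsConnected Γ) {r₀ e : ℝ}
    (hΓ : ChordCondition Γ r₀) (he0 : 0 < e) (he : 2 * e < r₀) {b : ℂ}
    (hb : e < Metric.infDist b Γ) :
    IsJordan {z | z ∈ connectedComponentIn Γᶜ b ∧ Metric.infDist z Γ = e} := by
  have hne := hconn.nonempty
  set D := connectedComponentIn Γᶜ b with hD
  set X := {z | z ∈ D ∧ Metric.infDist z Γ = e} with hX
  set U := {z | z ∈ D ∧ e < Metric.infDist z Γ} with hU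
  set V := {z | z ∈ D → Metric.infDist z Γ < e} with hV
  have hbΓ : b ∈ Γᶜ := fun h => by
    rw [Metric.infDist_zero_of_mem h] at hb; linarith
  have hDo : IsOpen D := hcpt.isClosed.isOpen_compl.connectedComponentIn
  have hbD : b ∈ D := mem_connectedComponentIn hbΓ
  have hUo : IsOpen U := hDo.inter (isOpen_lt continuous_const (Metric.continuous_infDist_pt Γ))
  have hUc : IsPreconnected U := isPreconnected_infDist_gt hcpt hne hΓ he0 he b
  obtain ⟨hVo, hVc⟩ := isOpen_and_isPreconnected_infDist_lt hcpt hconn he0 b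
  have hcompl : Xᶜ = U ∪ V := by
    ext z
    simp only [hX, hU, hV, mem_compl_iff, mem_union, mem_ofPred_eq]
    rcases lt_trichotomy (Metric.infDist z Γ) e with h | h | h
    · have := h.ne; tauto
    · have := h.not_lt; have := h.not_gt; tauto
    · have := h.ne'; have := h.not_gt; tauto
  have hXcl : IsClosed X := by
    rw [← isOpen_compl_iff, hcompl]; exact hUo.union hVo
  have hXc : IsCompact X :=
    (isCompact_infDist_le hcpt hne e).of_isClosed_subset hXcl fun z hz => hz.2.le
  have hball : ∀ x ∈ X, Metric.ball x e ⊆ D := fun x hx => by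
    have := ball_infDist_subset_connectedComponentIn hx.1
    rwa [hx.2] at this
  have hdist : ∀ x ∈ X, ∀ w ∈ Γ, e ≤ dist w x := fun x hx w hw => by
    rw [dist_comm, ← hx.2]; exact Metric.infDist_le_dist_of_mem hw
  have hdistb : ∀ w ∈ Γ, e < dist w b := fun w hw => by
    rw [dist_comm]; exact hb.trans_le (Metric.infDist_le_dist_of_mem hw)
  have hlog : ∀ x ∈ X, HasLogOn (fun w => (w - x) / (w - b)) Γ := fun x hx =>
    hasLogOn_of_isPreconnected hcpt.isClosed isPreconnected_connectedComponentIn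
      (connectedComponentIn_subset _ b) hx.1 hbD
  -- Normalization: `x` becomes the origin and the level becomes `1`.
  have hnorm1 : ∀ x ∈ X, ∀ v : ℂ, ‖v‖ = e → ∀ n ∈ (fun z => x + v * z) ⁻¹' Γ, 1 ≤ ‖n‖ := by
    intro x hx v hv n hn
    have h1 := hdist x hx _ hn
    rw [dist_eq_norm, add_sub_cancel_left, norm_mul, hv] at h1
    exact (le_mul_iff_one_le_right he0).1 h1
  have hnorm2 : ∀ x v n : ℂ, ‖v‖ = e → ‖n‖ = 1 → dist (x + v * n) x = e := by
    intro x v n hv hn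
    rw [dist_eq_norm, add_sub_cancel_left, norm_mul, hv, hn, mul_one]
  have hv0 : ∀ v : ℂ, ‖v‖ = e → v ≠ 0 := fun v hv => by rw [← norm_pos_iff, hv]; exact he0
  have hreg : ∀ x ∈ X, IsRegularPoint Γ e x → LocallyArcConnectedAt X x ∧ x ∈ closure U := by
    rintro x hx ⟨v, hv, hre⟩
    have hv0 := hv0 v hv
    obtain ⟨p, hp, hpx⟩ := hcpt.exists_infDist_eq_dist hne x
    have hpv : x + v * ((p - x) / v) = p := by field_simp; ring
    obtain ⟨h1, h2⟩ := locallyArcConnectedAt_of_re_neg (isCompact_preimage_affine hcpt x hv0)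
      (hnorm1 x hx v hv)
      (fun n hn hn1 => by
        have := hre _ hn (hnorm2 x v n hv hn1)
        rwa [add_sub_cancel_left, mul_div_cancel_left₀ _ hv0] at this)
      (n₀ := (p - x) / v) (by rw [mem_preimage, hpv]; exact hp)
      (by rw [norm_div, hv, ← dist_eq_norm, dist_comm, ← hpx, hx.2, div_self he0.ne'])
    constructor
    · have := h1.affine (D := D) hne hv0 (by rw [hv]; exact hball x hx)
      rwa [hv] at this
    · rw [Metric.mem_closure_iff]
      intro δ hδ
      obtain ⟨z, hz, hz1⟩ := h2 (min (δ / e) 1) (lt_min (by positivity) one_pos)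
      have h5 : dist (x + v * z) x = e * ‖z‖ := by
        rw [dist_eq_norm, add_sub_cancel_left, norm_mul, hv]
      refine ⟨x + v * z, ⟨hball x hx ?_, ?_⟩, ?_⟩
      · rw [Metric.mem_ball, h5]
        have := hz.trans_le (min_le_right _ _)
        nlinarith
      · rw [infDist_affine hne x hv0, hv]
        nlinarith
      · rw [dist_comm, h5, ← lt_div_iff₀' he0]
        exact hz.trans_le (min_le_left _ _)
  have hcrit : ∀ x ∈ X, IsCriticalPoint Γ e x → LocallyArcConnectedAt X x ∧ x ∈ closure U := by
    rintro x hx ⟨v, hv, him, hpΓ, hmΓ, hiΓ⟩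
    have hv0' := hv0 v hv
    set A := (fun z => x + v * z) ⁻¹' Γ with hA
    have hAn : ∀ n ∈ A, ‖n‖ = 1 → n.im ≤ 0 := fun n hn hn1 => by
      have := him _ hn (hnorm2 x v n hv hn1)
      rwa [add_sub_cancel_left, mul_div_cancel_left₀ _ hv0'] at this
    set b' := (b - x) / v with hb'
    have hb'0 : b' ≠ 0 := by
      refine div_ne_zero (sub_ne_zero.2 fun h => ?_) hv0'
      rw [h, hx.2] at hb
      exact lt_irrefl _ hb
    have hlog' : HasLogOn (fun z => z / (z - b')) {z | Metric.infDist z A < 1} := by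
      obtain ⟨g, hg, hge⟩ := hasLogOn_infDist_lt hne hΓ he.le (hdist x hx)
        (fun w hw => (hdistb w hw).le) (hlog x hx)
      have hmaps : MapsTo (fun z => x + v * z) {z | Metric.infDist z A < 1}
          {z | Metric.infDist z Γ < e} := by
        intro z hz
        rw [mem_ofPred_eq, infDist_affine hne x hv0', hv]
        exact (mul_lt_iff_lt_one_right he0).2 hz
      refine ⟨fun z => g (x + v * z), hg.comp (by fun_prop) hmaps, fun z hz => ?_⟩
      rw [hge _ (hmaps hz), hb']
      have h1 : x + v * z - b = v * (z - (b - x) / v) := by field_simp; ring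
      simp only [h1, add_sub_cancel_left]
      rw [mul_div_mul_left _ _ hv0']
    have hopen : ∀ r s : ℝ, 0 < s → s ≤ r → r < min 1 (‖b'‖ / 2) →
        ∃ u : ℝ, |u| ≤ r ∧ 1 ≤ Metric.infDist (u + s * Complex.I) A := by
      intro r s hs hsr hr
      have hr1 : r < 1 := hr.trans_le (min_le_left _ _)
      have hrb : r < ‖b'‖ / 2 := hr.trans_le (min_le_right _ _)
      have hr0 : 0 < r := hs.trans_le hsr
      by_contra! hcon
      set O : Set ℂ := Ioo (-r) r ×ℂ Ioo (-r) s with hO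
      have hOo : IsOpen O := isOpen_Ioo.reProdIm isOpen_Ioo
      have hclO : closure O = Icc (-r) r ×ℂ Icc (-r) s := by
        rw [hO, Complex.closure_reProdIm, closure_Ioo (by linarith), closure_Ioo (by linarith)]
      have hclO' : ∀ z ∈ closure O, ‖z‖ < ‖b'‖ := by
        intro z hz
        rw [hclO, Complex.mem_reProdIm] at hz
        have h1 : |z.re| ≤ r := abs_le.2 hz.1
        have h2 : |z.im| ≤ r := abs_le.2 ⟨hz.2.1, hz.2.2.trans hsr⟩
        linarith [Complex.norm_le_abs_re_add_abs_im z]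
      have hclO0 : ∀ z ∈ closure O, z - b' ≠ 0 := fun z hz h => by
        have := hclO' z hz
        rw [sub_eq_zero.1 h] at this
        exact lt_irrefl _ this
      have hnear : ∀ z n : ℂ, n ∈ A → dist z n ^ 2 < 1 → Metric.infDist z A < 1 := by
        intro z n hn hzn
        refine (Metric.infDist_le_dist_of_mem hn).trans_lt ?_
        exact (sq_lt_one_iff₀ dist_nonneg).1 hzn
      refine not_hasLogOn_frontier hOo ?_ (a := 0) ?_ (k := fun z => (z - b')⁻¹) (n := 1)
        (ContinuousOn.inv₀ (by fun_prop) hclO0) (fun z hz => inv_ne_zero (hclO0 z hz)) one_ne_zero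
        (K := {z | Metric.infDist z A < 1}) ?_ (by simpa [div_eq_mul_inv] using hlog')
      · refine (Metric.isBounded_ball (x := (0 : ℂ)) (r := ‖b'‖)).subset fun z hz => ?_
        rw [mem_ball_zero_iff]
        exact hclO' z (subset_closure hz)
      · rw [hO, Complex.mem_reProdIm]
        simp only [Complex.zero_re, Complex.zero_im, mem_Ioo]
        exact ⟨⟨by linarith, hr0⟩, by linarith, hs⟩
      · -- The bottom and the sides of the box are covered by the unit discs about `-i` and `±1`.
        intro z hz
        have hzcl := frontier_subset_closure hz
        rw [hclO, Complex.mem_reProdIm] at hzcl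
        obtain ⟨⟨hz1, hz2⟩, hz3, hz4⟩ := hzcl
        rw [hOo.frontier_eq] at hz
        have hzO := hz.2
        rw [hO, Complex.mem_reProdIm, mem_Ioo, mem_Ioo] at hzO
        rw [mem_ofPred_eq]
        by_cases h1 : z.im = s
        · have := hcon z.re (abs_le.2 ⟨hz1, hz2⟩)
          rwa [← h1, Complex.re_add_im] at this
        by_cases h2 : z.re = r
        · refine hnear z 1 (by simpa [hA] using hpΓ) ?_
          rw [dist_sq_eq, Complex.one_re, Complex.one_im, h2]
          nlinarith
        by_cases h3 : z.re = -r
        · refine hnear z (-1) (by simpa [hA, ← sub_eq_add_neg] using hmΓ) ?_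
          rw [dist_sq_eq, Complex.neg_re, Complex.neg_im, Complex.one_re, Complex.one_im, h3]
          nlinarith
        have h4 : z.im = -r := by
          by_contra h4
          exact hzO ⟨⟨lt_of_le_of_ne hz1 (Ne.symm h3), lt_of_le_of_ne hz2 h2⟩,
            lt_of_le_of_ne hz3 (Ne.symm h4), lt_of_le_of_ne hz4 h1⟩
        refine hnear z (-Complex.I) (by
          simpa [hA, mul_comm v, ← sub_eq_add_neg] using hiΓ) ?_
        rw [dist_sq_eq, Complex.neg_re, Complex.neg_im, Complex.I_re, Complex.I_im, h4]
        nlinarith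
    obtain ⟨h1, h2⟩ := locallyArcConnectedAt_of_cusp (isCompact_preimage_affine hcpt x hv0')
      (hnorm1 x hx v hv) hAn (by simpa [hA] using hpΓ)
      (by simpa [hA, ← sub_eq_add_neg] using hmΓ)
      (by simpa [hA, mul_comm v, ← sub_eq_add_neg] using hiΓ)
      (lt_min one_pos (half_pos (norm_pos_iff.2 hb'0))) hopen
    constructor
    · have := h1.affine (D := D) hne hv0' (by rw [hv]; exact hball x hx)
      rwa [hv] at this
    · -- Points of the level set in the cusp are regular.
      rw [← closure_closure, Metric.mem_closure_iff]
      intro δ hδ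
      obtain ⟨z, hz, hz1, hzn⟩ := h2 (min (δ / e) 1) (lt_min (by positivity) one_pos)
      have h5 : dist (x + v * z) x = e * ‖z‖ := by
        rw [dist_eq_norm, add_sub_cancel_left, norm_mul, hv]
      have hyX : x + v * z ∈ X := by
        refine ⟨hball x hx ?_, ?_⟩
        · rw [Metric.mem_ball, h5]
          have := hz.trans_le (min_le_right _ _)
          nlinarith
        · rw [infDist_affine hne x hv0', hv, hz1, mul_one]
      refine ⟨x + v * z, ?_, ?_⟩
      · rcases isRegularPoint_or_isCriticalPoint hcpt hΓ he0 he.le (hdist _ hyX) hdistb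
          (hlog _ hyX) with h | h
        · exact (hreg _ hyX h).2
        · exfalso
          obtain ⟨v', hv', -, h6, -, h7⟩ := h
          have hq : ‖v' / v‖ = 1 := by rw [norm_div, hv, hv', div_self he0.ne']
          have h8 := hzn (z + v' / v) (by
            rw [mem_preimage, mul_add, mul_div_cancel₀ _ hv0', ← add_assoc]; exact h6)
            (by rw [dist_eq_norm, add_sub_cancel_left, hq])
          have h9 := hzn (z - Complex.I * (v' / v)) (by
            rw [mem_preimage, mul_sub, mul_left_comm, mul_div_cancel₀ _ hv0', ← add_sub_assoc]
            exact h7)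
            (by rw [dist_eq_norm, sub_sub_cancel_left, norm_neg, norm_mul, Complex.norm_I, hq,
              one_mul])
          rw [add_sub_cancel_left] at h8
          rw [sub_sub_cancel_left, Complex.neg_im, abs_neg, Complex.I_mul_im] at h9
          have h10 := Complex.sq_norm (v' / v)
          rw [hq, Complex.normSq_apply] at h10
          rw [abs_le] at h8 h9
          nlinarith
      · rw [dist_comm, h5, ← lt_div_iff₀' he0]
        exact hz.trans_le (min_le_left _ _)
  have hloc : ∀ x ∈ X, LocallyArcConnectedAt X x ∧ x ∈ closure U := fun x hx => by
    rcases isRegularPoint_or_isCriticalPoint hcpt hΓ he0 he.le (hdist x hx) hdistb (hlog x hx)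
      with h | h
    · exact hreg x hx h
    · exact hcrit x hx h
  obtain ⟨p, hp⟩ := hne
  have hpV : p ∈ V := fun h => absurd hp (connectedComponentIn_subset _ _ h)
  have hbU : b ∈ U := ⟨hbD, hb⟩
  have hUV : ∀ z, z ∈ U → z ∉ V := fun z hz hz' => lt_asymm hz.2 (hz' hz.1)
  have hUX : U ⊆ Xᶜ := hcompl ▸ subset_union_left
  have hVX : V ⊆ Xᶜ := hcompl ▸ subset_union_right
  have hnoLog : ¬ HasLogOn (fun z => (z - b) / (z - p)) X := by
    intro h
    have heq := connectedComponentIn_eq_of_hasLogOn hXc (hUX hbU) (hVX hpV) h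
    have hsub : connectedComponentIn Xᶜ b ⊆ U :=
      isPreconnected_connectedComponentIn.subset_left_of_subset_union hUo hVo
        (disjoint_left.2 hUV) (hcompl ▸ connectedComponentIn_subset _ _)
        ⟨b, mem_connectedComponentIn (hUX hbU), hbU⟩
    exact hUV p (hsub (heq ▸ mem_connectedComponentIn (hVX hpV))) hpV
  have hsub0 : ∀ {a z : ℂ}, a ∈ Xᶜ → z ∈ X → z - a ≠ 0 := fun ha hz h =>
    ha (by rwa [← sub_eq_zero.1 h])
  obtain ⟨C, hCX, hC⟩ : ∃ C ⊆ X, IsJordan C := by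
    by_contra hno
    refine hnoLog (hasLogOn_of_no_isJordan (fun x hx => (hloc x hx).1) hno ?_ ?_)
    · exact ContinuousOn.div (by fun_prop) (by fun_prop) fun z hz => hsub0 (hVX hpV) hz
    · exact fun z hz => div_ne_zero (hsub0 (hUX hbU) hz) (hsub0 (hVX hpV) hz)
  have hXV : X ⊆ closure V := by
    intro x hx
    obtain ⟨q, hq, hqx⟩ := hcpt.exists_infDist_eq_dist ⟨p, hp⟩ x
    rw [hx.2] at hqx
    rw [Metric.mem_closure_iff]
    intro δ hδ
    set t := min (δ / (2 * e)) 1 with ht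
    have ht0 : 0 < t := lt_min (by positivity) one_pos
    have ht1 : t ≤ 1 := min_le_right _ _
    refine ⟨AffineMap.lineMap x q t, fun _ => ?_, ?_⟩
    · refine (Metric.infDist_le_dist_of_mem hq).trans_lt ?_
      rw [dist_lineMap_right, ← hqx, Real.norm_eq_abs, abs_of_nonneg (by linarith)]
      nlinarith
    · rw [dist_left_lineMap, ← hqx, Real.norm_eq_abs, abs_of_pos ht0]
      have h1 : t * e ≤ δ / (2 * e) * e := by gcongr; exact min_le_left _ _
      have h2 : δ / (2 * e) * e = δ / 2 := by field_simp
      linarith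
  rw [← hC.eq_of_subset hCX hUc hVc (fun x hx => (hloc x hx).2) hXV hcompl]
  exact hC

/-! ### From the complex plane to the Euclidean plane -/

/-- The standard identification of `ℂ` with the Euclidean plane. -/
noncomputable def planeIsometry : ℂ ≃ₗᵢ[ℝ] Plane :=
  Complex.orthonormalBasisOneI.repr

lemma isJordanCurve_iff (Γ : Set Plane) : IsJordanCurve Γ ↔ IsJordan (planeIsometry ⁻¹' Γ) := by
  constructor
  · rintro ⟨f, hf, hinj, rfl⟩
    refine ⟨planeIsometry.symm ∘ f, planeIsometry.symm.continuous.comp hf,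
      planeIsometry.symm.injective.comp hinj, ?_⟩
    ext z
    simp [LinearIsometryEquiv.symm_apply_eq]
  · rintro ⟨f, hf, hinj, h⟩
    refine ⟨planeIsometry ∘ f, planeIsometry.continuous.comp hf,
      planeIsometry.injective.comp hinj, ?_⟩
    rw [range_comp, h, image_preimage_eq _ planeIsometry.surjective]

lemma infDist_planeIsometry (Γ : Set Plane) (z : ℂ) :
    Metric.infDist (planeIsometry z) Γ = Metric.infDist z (planeIsometry ⁻¹' Γ) := by
  conv_lhs => rw [← image_preimage_eq Γ planeIsometry.surjective]
  exact Metric.infDist_image planeIsometry.isometry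

lemma planeIsometry_mem_interiorDomain {Γ : Set Plane} {z : ℂ} :
    planeIsometry z ∈ interiorDomain Γ ↔ z ∈ (planeIsometry ⁻¹' Γ)ᶜ ∧
      Bornology.IsBounded (connectedComponentIn (planeIsometry ⁻¹' Γ)ᶜ z) := by
  refine and_congr_right fun hz => ?_
  have hz' : z ∈ (planeIsometry ⁻¹' Γ)ᶜ := hz
  have h := planeIsometry.toHomeomorph.image_connectedComponentIn hz'
  rw [← preimage_compl] at h
  simp only [LinearIsometryEquiv.coe_toHomeomorph] at h
  rw [image_preimage_eq _ planeIsometry.surjective] at h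
  rw [← preimage_compl, ← h]
  exact ⟨fun hb => by
    simpa only [preimage_image_eq _ planeIsometry.injective] using
      planeIsometry.antilipschitz.isBounded_preimage hb,
    fun hb => planeIsometry.lipschitz.isBounded_image hb⟩

lemma abs_im_div_mul_dist_le (p q w : ℂ) :
    |((w - p) / (q - p)).im| * dist (planeIsometry p) (planeIsometry q) ≤
      Metric.infDist (planeIsometry w)
        (line[ℝ, planeIsometry p, planeIsometry q] : Set Plane) := by
  rcases eq_or_ne p q with rfl | hpq
  · simp
  have hqp : q - p ≠ 0 := sub_ne_zero.2 hpq.symm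
  rw [Metric.le_infDist ⟨_, left_mem_affineSpan_pair ℝ _ _⟩]
  intro m hm
  obtain ⟨t, rfl⟩ := mem_affineSpan_pair_iff_exists_lineMap_eq.1 hm
  have h1 : AffineMap.lineMap (planeIsometry p) (planeIsometry q) t =
      planeIsometry (p + t * (q - p)) := by
    rw [AffineMap.lineMap_apply, vsub_eq_sub, vadd_eq_add, ← map_sub, ← map_smul, ← map_add,
      Complex.real_smul, add_comm]
  rw [h1, planeIsometry.dist_map, planeIsometry.dist_map, dist_comm p, dist_eq_norm, dist_eq_norm]
  have h2 : w - (p + t * (q - p)) = ((w - p) / (q - p) - t) * (q - p) := by field_simp; ring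
  rw [h2, norm_mul]
  gcongr
  simpa using Complex.abs_im_le_norm ((w - p) / (q - p) - t)

lemma HasChordalProperty.chordCondition {Γ : Set Plane} {r₀ : ℝ}
    (h : HasChordalProperty Γ (1 / 2) r₀) : ChordCondition (planeIsometry ⁻¹' Γ) r₀ := by
  intro p hp q hq hpq hd
  obtain ⟨σ, ⟨⟨g, hg, -, hg0, hg1, rfl⟩, hσΓ, -⟩, hdev⟩ := h _ hp _ hq
    (planeIsometry.injective.ne hpq) (by rwa [planeIsometry.dist_map])
  have hpos : 0 < dist (planeIsometry p) (planeIsometry q) :=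
    dist_pos.2 (planeIsometry.injective.ne hpq)
  have hpre : planeIsometry ⁻¹' range g = planeIsometry.symm '' range g :=
    (planeIsometry.toEquiv.image_symm_eq_preimage _).symm
  refine ⟨planeIsometry ⁻¹' range g, preimage_mono hσΓ, ?_, ⟨0, hg0⟩, ⟨1, hg1⟩, fun w hw => ?_⟩
  · rw [hpre]
    exact (isPreconnected_range hg).image _ planeIsometry.symm.continuous.continuousOn
  · have hbdd : BddAbove ((fun z => Metric.infDist z
        (line[ℝ, planeIsometry p, planeIsometry q] : Set Plane)) '' range g) :=
      ((isCompact_range hg).image (Metric.continuous_infDist_pt _)).bddAbove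
    have h1 := le_csSup hbdd (mem_image_of_mem _ hw)
    have h2 := abs_im_div_mul_dist_le p q w
    rw [chordalDeviation, one_div, inv_mul_le_iff₀ hpos] at hdev
    refine le_of_mul_le_mul_right ?_ hpos
    linarith

lemma signedDistance_planeIsometry_of_mem {Γ : Set Plane} {z : ℂ}
    (h : planeIsometry z ∈ interiorDomain Γ) :
    signedDistance Γ (planeIsometry z) = Metric.infDist z (planeIsometry ⁻¹' Γ) := by
  rw [signedDistance, if_pos h, infDist_planeIsometry]

lemma signedDistance_planeIsometry_of_notMem {Γ : Set Plane} {z : ℂ}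
    (h : planeIsometry z ∉ interiorDomain Γ) :
    signedDistance Γ (planeIsometry z) = -Metric.infDist z (planeIsometry ⁻¹' Γ) := by
  rw [signedDistance, if_neg h, infDist_planeIsometry]

lemma IsJordan.isCompact {C : Set ℂ} (hC : IsJordan C) : IsCompact C := by
  obtain ⟨f, hf, -, rfl⟩ := hC
  exact isCompact_range hf

lemma IsJordan.isConnected {C : Set ℂ} (hC : IsJordan C) : IsConnected C := by
  obtain ⟨f, hf, -, rfl⟩ := hC
  exact isConnected_range hf

/-- A Jordan curve has a bounded complementary component: otherwise all components would be
unbounded, hence equal, and the complement would be connected. -/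
lemma IsJordanCurve.nonempty_interiorDomain {Γ : Set Plane} (hΓ : IsJordanCurve Γ) :
    (interiorDomain Γ).Nonempty := by
  rw [isJordanCurve_iff] at hΓ
  by_contra hempty
  refine hΓ.not_isPreconnected_compl (isPreconnected_of_forall_pair fun a ha b hb => ?_)
  have hunb : ∀ z ∈ (planeIsometry ⁻¹' Γ)ᶜ,
      ¬ Bornology.IsBounded (connectedComponentIn (planeIsometry ⁻¹' Γ)ᶜ z) := fun z hz hbd =>
    hempty ⟨_, planeIsometry_mem_interiorDomain.2 ⟨hz, hbd⟩⟩
  have heq := connectedComponentIn_eq_of_not_isBounded hΓ.isCompact.isBounded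
    (hunb a ha) (hunb b hb)
  exact ⟨_, connectedComponentIn_subset _ a, mem_connectedComponentIn ha,
    heq ▸ mem_connectedComponentIn hb, isPreconnected_connectedComponentIn⟩

/-- The unbounded component of the complement of a bounded set contains points at arbitrarily
large distance from the set. -/
lemma exists_infDist_gt_not_isBounded {K : Set ℂ} (hK : Bornology.IsBounded K) (hne : K.Nonempty)
    (e : ℝ) : ∃ b, e < Metric.infDist b K ∧
      ¬ Bornology.IsBounded (connectedComponentIn Kᶜ b) := by
  obtain ⟨R, hR⟩ := hK.subset_closedBall 0
  have hRS : R ≤ max R 0 := le_max_left _ _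
  set S := max R 0
  have hS : 0 ≤ S := le_max_right _ _
  have hKS : K ⊆ Metric.closedBall 0 S := hR.trans (Metric.closedBall_subset_closedBall hRS)
  set b : ℂ := ((S + |e| + 1 : ℝ) : ℂ)
  have hbn : ‖b‖ = S + |e| + 1 := by
    rw [Complex.norm_real, Real.norm_eq_abs, abs_of_nonneg (by positivity)]
  refine ⟨b, ?_, fun hbd => ?_⟩
  · refine (lt_of_le_of_lt (le_abs_self e) (lt_add_one _)).trans_le
      ((Metric.le_infDist hne).2 fun p hp => ?_)
    have h1 : ‖p‖ ≤ S := mem_closedBall_zero_iff.1 (hKS hp)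
    rw [dist_eq_norm]
    linarith [norm_sub_norm_le b p]
  · have hbS : b ∈ (Metric.closedBall (0 : ℂ) S)ᶜ := by
      rw [mem_compl_iff, mem_closedBall_zero_iff, hbn]
      linarith [abs_nonneg e]
    have hsub := (isPreconnected_compl_closedBall hS).subset_connectedComponentIn hbS
      (compl_subset_compl.2 hKS)
    refine NormedSpace.unbounded_univ ℝ ℂ ?_
    rw [← union_compl_self (Metric.closedBall (0 : ℂ) S)]
    exact Metric.isBounded_closedBall.union (hbd.subset hsub)

lemma IsJordanCurve.isJordanCurve_levelSet {Γ : Set Plane} (hΓ : IsJordanCurve Γ) {r₀ : ℝ}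
    (hchord : HasChordalProperty Γ (1 / 2) r₀) {ε : ℝ} (hε0 : 0 < |ε|) (hε : |ε| < r₀ / 2)
    (hx : ∃ x, ε < signedDistance Γ x) : IsJordanCurve (levelSet Γ ε) := by
  have hcc := hchord.chordCondition
  rw [isJordanCurve_iff] at hΓ ⊢
  set Γ' := planeIsometry ⁻¹' Γ with hΓ'
  have hcpt := hΓ.isCompact
  have hmain := fun {b : ℂ} => isJordan_infDist_eq (b := b) hcpt hΓ.isConnected hcc hε0
    (by linarith)
  rcases lt_or_gt_of_ne (abs_pos.1 hε0) with hneg | hpos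
  · rw [abs_of_neg hneg] at hmain
    obtain ⟨b, hb, hbu⟩ := exists_infDist_gt_not_isBounded hcpt.isBounded hΓ.isConnected.nonempty
      (-ε)
    convert hmain hb using 1
    ext z
    have h0 := Metric.infDist_nonneg (x := z) (s := planeIsometry ⁻¹' Γ)
    by_cases hz : planeIsometry z ∈ interiorDomain Γ
    · have hzm : z ∉ connectedComponentIn Γ'ᶜ b := fun h =>
        hbu (connectedComponentIn_eq h ▸ (planeIsometry_mem_interiorDomain.1 hz).2)
      simp only [levelSet, mem_preimage, mem_ofPred_eq, signedDistance_planeIsometry_of_mem hz,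
        hzm, false_and, iff_false]
      linarith
    · simp only [levelSet, mem_preimage, mem_ofPred_eq, signedDistance_planeIsometry_of_notMem hz,
        neg_eq_iff_eq_neg]
      refine (and_iff_right_of_imp fun hze => ?_).symm
      have hzΓ : z ∈ Γ'ᶜ := fun h => by
        rw [Metric.infDist_zero_of_mem h] at hze
        linarith
      have hzu : ¬ Bornology.IsBounded (connectedComponentIn Γ'ᶜ z) := fun h =>
        hz (planeIsometry_mem_interiorDomain.2 ⟨hzΓ, h⟩)
      rw [← connectedComponentIn_eq_of_not_isBounded hcpt.isBounded hzu hbu]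
      exact mem_connectedComponentIn hzΓ
  · rw [abs_of_pos hpos] at hmain
    obtain ⟨x, hx⟩ := hx
    obtain ⟨b, rfl⟩ := planeIsometry.surjective x
    have hbi : planeIsometry b ∈ interiorDomain Γ := by
      by_contra h
      rw [signedDistance_planeIsometry_of_notMem h] at hx
      linarith [Metric.infDist_nonneg (x := b) (s := planeIsometry ⁻¹' Γ)]
    rw [signedDistance_planeIsometry_of_mem hbi] at hx
    rw [planeIsometry_mem_interiorDomain] at hbi
    convert hmain hx using 1
    ext z
    by_cases hz : planeIsometry z ∈ interiorDomain Γ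
    · have hz' := planeIsometry_mem_interiorDomain.1 hz
      have hzb := hΓ.connectedComponentIn_eq hz'.1 hbi.1 hz'.2 hbi.2
      have hzm : z ∈ connectedComponentIn Γ'ᶜ b := hzb ▸ mem_connectedComponentIn hz'.1
      simp only [levelSet, mem_preimage, mem_ofPred_eq, signedDistance_planeIsometry_of_mem hz]
      exact (and_iff_right hzm).symm
    · have hzm : z ∉ connectedComponentIn Γ'ᶜ b := fun h => hz
        (planeIsometry_mem_interiorDomain.2 ⟨connectedComponentIn_subset _ _ h,
          connectedComponentIn_eq h ▸ hbi.2⟩)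
      have := Metric.infDist_nonneg (x := z) (s := planeIsometry ⁻¹' Γ)
      simp only [levelSet, mem_preimage, mem_ofPred_eq, signedDistance_planeIsometry_of_notMem hz,
        hzm, false_and, iff_false]
      linarith

end LevelJordan

theorem theorem1p1 (Γ : Set LevelJordan.Plane) (hΓ : LevelJordan.IsJordanCurve Γ)
    (r₀ : ℝ) (hr₀ : 0 < r₀) (hchord : LevelJordan.HasChordalProperty Γ (1 / 2) r₀) :
    LevelJordan.HasLevelJordanCurveProperty Γ ∧
      ∀ ε : ℝ, 0 < |ε| → |ε| < r₀ / 2 →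
        (∃ x : LevelJordan.Plane, ε < LevelJordan.signedDistance Γ x) →
          LevelJordan.IsJordanCurve (LevelJordan.levelSet Γ ε) := by
  have hmain : ∀ ε : ℝ, 0 < |ε| → |ε| < r₀ / 2 →
      (∃ x : LevelJordan.Plane, ε < LevelJordan.signedDistance Γ x) →
        LevelJordan.IsJordanCurve (LevelJordan.levelSet Γ ε) := fun ε h0 hε hx =>
    hΓ.isJordanCurve_levelSet hchord h0 hε hx
  refine ⟨?_, hmain⟩
  obtain ⟨x, hx⟩ := hΓ.nonempty_interiorDomain
  have hpos : 0 < LevelJordan.signedDistance Γ x := by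
    obtain ⟨f, hf, -, rfl⟩ := hΓ
    rw [LevelJordan.signedDistance, if_pos hx]
    exact ((isCompact_range hf).isClosed.notMem_iff_infDist_pos (Set.range_nonempty f)).1 hx.1
  refine ⟨min (r₀ / 4) (LevelJordan.signedDistance Γ x / 2), by positivity, fun ε h0 hε => ?_⟩
  have h1 := hε.trans (min_le_left _ _)
  have h2 := hε.trans (min_le_right _ _)
  exact hmain ε h0 (by linarith) ⟨x, (le_abs_self ε).trans_lt (by linarith)⟩
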